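/- **Theorem 1.** Fix a real number $a>0$. Let $\zeta(s,a)$ be the Hurwitz zeta function, i.e. the analytic continuation to $s\in\mathbb C\setminus\{1\}$ of $\sum_{m\ge 0}(m+a)^{-s}$ ($\operatorname{Re}s>1$), and let $\zeta_n(a)=\frac1{n!}\,\partial_s^n\zeta(s,a)|_{s=0}$, so that $$\zeta(s,a)=\sum_{n=0}^\infty \zeta_n(a)\,s^n\qquad(|s|<1).$$ For $n,k\ge 0$ put $$t_{n,k}=(-1)^{k+1}\left[{k\atop n}\right]\frac{B_{k+1}(a-1)}{(k+1)!},$$ where $\left[{k\atop n}\right]$ are the unsigned Stirling numbers of the first kind (zero for $k<n$) and $B_j(x)$ are the Bernoulli polynomials. Then for every $n\ge 0$ $$\zeta_n(a)=-1+\sum_{k=n}^\infty t_{n,k}$$ as a semi-convergent series, that is, as the case $z=1$ of an asymptotic expansion in powers of $1/z$, in the following sense. There is a function $F_n$, holomorphic on a neighbourhood of the half-plane $\operatorname{Re}z\ge 1$, with $\zeta_n(a)=-1+F_n(1)$ and, more generally, with $$-x+F_n(x)=\frac1{n!}\,\partial_s^n\bigl(x^s\zeta(s,x+a-1)\bigr)\Big|_{s=0}\qquad(x\ge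 1\text{ real}),$$ such that $F_n(z)\sim\sum_{k\ge n}t_{n,k}z^{-k}$ with an error of the order of the first power neglected: for each $0<\rho<2\pi$ there is a constant $C$ with $$\Bigl|F_n(z)-\sum_{n\le k<K}t_{n,k}z^{-k}\Bigr|\le C\,\frac{K!}{\rho^K|z|^K}\qquad(K\ge 0,\ \operatorname{Re}z\ge 1).$$ (At most one function on the half-plane satisfies these bounds, so the numbers $t_{n,k}$ determine $F_n(1)$.) For $n=0$ all terms with $k\ge1$ vanish and the identity is exact: $\zeta_0(a)=-1-B_1(a-1)$. For $n\ge 1$ the series $\sum_k t_{n,k}$ diverges; as $k\to\infty$ its terms are $O(g_k)$ but not $o(g_k)$, where $g_k=(k-1)!\,(\log k)^{n-1}/(2\pi)^k$. -/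

import Mathlib

open Filter Asymptotics Topology
open scoped Nat

namespace HurwitzTaylor

/-- The Hurwitz zeta function `ζ(s, a)` for real `a > 0`: the analytic continuation in `s` of
`∑ 1 / (m + a) ^ s`. Mathlib's `HurwitzZeta.hurwitzZeta` depends on `a` only modulo `1` and is the
function with the representative of `a` in `(0, 1]`; for `a > 1` the finitely many surplus terms of
the Dirichlet series are removed. See `hasSum_hurwitz` and `differentiableAt_hurwitz`. -/
noncomputable def hurwitz (a : ℝ) (s : ℂ) : ℂ :=
  HurwitzZeta.hurwitzZeta (a : UnitAddCircle) s -
    ∑ j ∈ Finset.range (⌈a⌉₊ - 1), 1 / ((j : ℂ) + ((a - ((⌈a⌉₊ - 1 : ℕ) : ℝ) : ℝ) : ℂ)) ^ s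

lemma sub_ceil_mem {a : ℝ} (ha : 0 < a) :
    0 < a - ((⌈a⌉₊ - 1 : ℕ) : ℝ) ∧ a - ((⌈a⌉₊ - 1 : ℕ) : ℝ) ≤ 1 := by
  have h1 : 1 ≤ ⌈a⌉₊ := Nat.ceil_pos.mpr ha
  have h2 := Nat.ceil_lt_add_one ha.le
  have h3 := Nat.le_ceil a
  push_cast [h1]
  constructor <;> linarith

/-- For `Re s > 1` the function is the Hurwitz series. -/
theorem hasSum_hurwitz {a : ℝ} (ha : 0 < a) {s : ℂ} (hs : 1 < s.re) :
    HasSum (fun m : ℕ => 1 / ((m : ℂ) + (a : ℂ)) ^ s) (hurwitz a s) := by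
  obtain ⟨h0, h1⟩ := sub_ceil_mem ha
  set m := ⌈a⌉₊ - 1 with hm
  have key := HurwitzZeta.hasSum_hurwitzZeta_of_one_lt_re (a := a - (m : ℝ)) ⟨h0.le, h1⟩ hs
  have hc : ((a - (m : ℝ) : ℝ) : UnitAddCircle) = (a : UnitAddCircle) := by
    have hz : ((m : ℝ) : UnitAddCircle) = 0 :=
      (AddCircle.coe_eq_zero_iff (1 : ℝ)).mpr ⟨m, by simp⟩
    rw [AddCircle.coe_sub, hz, sub_zero]
  rw [hc] at key
  have key2 := (hasSum_nat_add_iff' m).mpr key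
  have hf : (fun i : ℕ => 1 / ((i : ℂ) + (a : ℂ)) ^ s) =
      fun i : ℕ => 1 / (((i + m : ℕ) : ℂ) + ((a - (m : ℝ) : ℝ) : ℂ)) ^ s := by
    funext i
    congr 2
    push_cast
    ring
  rw [hf]
  exact key2

/-- Away from `s = 1` the function is holomorphic in `s`. -/
theorem differentiableAt_hurwitz {a : ℝ} (ha : 0 < a) {s : ℂ} (hs : s ≠ 1) :
    DifferentiableAt ℂ (hurwitz a) s := by
  obtain ⟨h0, -⟩ := sub_ceil_mem ha
  unfold hurwitz
  refine (HurwitzZeta.differentiableAt_hurwitzZeta _ hs).sub (DifferentiableAt.fun_sum ?_)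
  intro j _
  have hne : (j : ℂ) + ((a - ((⌈a⌉₊ - 1 : ℕ) : ℝ) : ℝ) : ℂ) ≠ 0 := by
    have : (j : ℝ) + (a - ((⌈a⌉₊ - 1 : ℕ) : ℝ)) ≠ 0 := by positivity
    exact_mod_cast this
  refine (differentiableAt_const _).div (differentiableAt_id.const_cpow (Or.inl hne)) ?_
  exact fun h => hne ((Complex.cpow_eq_zero_iff _ _).mp h).1

/-- The coefficient of `s ^ n` in the Maclaurin series of `f`. -/
noncomputable def maclaurinCoeff (f : ℂ → ℂ) (n : ℕ) : ℂ :=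
  iteratedDeriv n f 0 / (n ! : ℂ)

/-- `ζ_n(a)`, the coefficient of `s ^ n` in the Maclaurin series of `s ↦ ζ(s, a)`. -/
noncomputable def zetaCoeff (a : ℝ) (n : ℕ) : ℂ := maclaurinCoeff (hurwitz a) n

/-- The term `(-1) ^ (k + 1) [k n] B_{k+1}(a - 1) / (k + 1)!`. It is `0` for `k < n`, because
`[k n] = 0` there, so that sums over `k ≥ n` may be written as sums over all `k`. -/
noncomputable def term (a : ℝ) (n k : ℕ) : ℝ :=
  (-1) ^ (k + 1) * (Nat.stirlingFirst k n : ℝ) *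
    Polynomial.aeval (a - 1) (Polynomial.bernoulli (k + 1)) / ((k + 1)! : ℝ)

/-- `F(z) ~ ∑ c_k z^{-k}` is a semi-convergent (asymptotic) expansion on the half-plane `Re z ≥ 1`:
for every number `K` of terms retained, the error is of the order `z ^ (-K)` of the first term
neglected, uniformly in the half-plane, and with a constant that grows with `K` at most like
`K! / ρ ^ K` for each `ρ < R`. By Watson's uniqueness theorem a sequence `c` admits at most
one such `F` on the half-plane, so `c` alone determines the value `F 1` that is
attached to the possibly divergent series `∑ c_k` obtained for `z = 1`. -/
structure IsSemiconvergentExpansion (c : ℕ → ℂ) (R : ℝ) (F : ℂ → ℂ) : Prop where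
  analytic : AnalyticOnNhd ℂ F {z : ℂ | 1 ≤ z.re}
  error_le : ∀ ρ : ℝ, 0 < ρ → ρ < R → ∃ C : ℝ, ∀ (K : ℕ) (z : ℂ), 1 ≤ z.re →
    ‖F z - ∑ k ∈ Finset.range K, c k / z ^ k‖ ≤ C * (K ! : ℝ) / (ρ * ‖z‖) ^ K

end HurwitzTaylor

namespace HurwitzTaylor
open MeasureTheory Set

/-! ### Holomorphic parameter integrals -/

theorem differentiableAt_integral_of_dominated {α : Type*} [MeasurableSpace α] {μ : Measure α}
    {f : ℂ → α → ℂ} {bound : α → ℝ} {U : Set ℂ} {z₀ : ℂ} (hU : U ∈ 𝓝 z₀)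
    (hmeas : ∀ z ∈ U, AEStronglyMeasurable (f z) μ)
    (hdiff : ∀ᵐ a ∂μ, DifferentiableOn ℂ (fun z => f z a) U)
    (hbound : ∀ᵐ a ∂μ, ∀ z ∈ U, ‖f z a‖ ≤ bound a) (hint : Integrable bound μ) :
    DifferentiableAt ℂ (fun z => ∫ a, f z a ∂μ) z₀ := by
  obtain ⟨ε, hε, hεU⟩ := Metric.mem_nhds_iff.1 hU
  set r := ε / 3 with hr
  have hr0 : 0 < r := by positivity
  have hsub : ∀ z ∈ Metric.ball z₀ r, Metric.closedBall z r ⊆ Metric.ball z₀ ε := by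
    intro z hz w hw
    rw [Metric.mem_ball] at hz ⊢
    rw [Metric.mem_closedBall] at hw
    have := dist_triangle w z z₀
    linarith
  have hz₀U : z₀ ∈ U := mem_of_mem_nhds hU
  have hderiv : ∀ᵐ a ∂μ, ∀ z ∈ Metric.ball z₀ r,
      HasDerivAt (fun z => f z a) (deriv (fun z => f z a) z) z := by
    filter_upwards [hdiff] with a ha z hz
    refine ((ha.mono hεU).differentiableAt (Metric.isOpen_ball.mem_nhds ?_)).hasDerivAt
    exact hsub z hz (Metric.mem_closedBall_self hr0.le)
  refine (hasDerivAt_integral_of_dominated_loc_of_deriv_le (μ := μ) (F := f)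
    (F' := fun z a => deriv (fun z => f z a) z) (bound := fun a => bound a / r)
    (Metric.ball_mem_nhds z₀ hr0) ?_ ?_ ?_ ?_ (hint.div_const r) hderiv).2.differentiableAt
  · filter_upwards [hU] with z hz using hmeas z hz
  · refine hint.mono' (hmeas z₀ hz₀U) ?_
    filter_upwards [hbound] with a ha using ha z₀ hz₀U
  · have hseq : Tendsto (fun n : ℕ => z₀ + ((r / (n + 2) : ℝ) : ℂ)) atTop (𝓝[≠] z₀) := by
      refine tendsto_nhdsWithin_iff.2 ⟨?_, Eventually.of_forall fun n => ?_⟩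
      · have h1 : Tendsto (fun n : ℕ => r / ((n : ℝ) + 2)) atTop (𝓝 0) :=
          tendsto_const_nhds.div_atTop
            (tendsto_atTop_add_const_right _ _ tendsto_natCast_atTop_atTop)
        have h2 := (Complex.continuous_ofReal.tendsto 0).comp h1
        simpa using h2.const_add z₀
      · have : r / ((n : ℝ) + 2) ≠ 0 := by positivity
        simpa using (by exact_mod_cast this : ((r / (n + 2) : ℝ) : ℂ) ≠ 0)
    have hmem : ∀ n : ℕ, z₀ + ((r / (n + 2) : ℝ) : ℂ) ∈ U := by
      intro n
      apply hεU
      rw [Metric.mem_ball, dist_eq_norm, add_sub_cancel_left, Complex.norm_real, Real.norm_eq_abs,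
        abs_of_pos (by positivity)]
      have : r / ((n : ℝ) + 2) ≤ r := div_le_self hr0.le (by
        have : (0 : ℝ) ≤ n := n.cast_nonneg
        linarith)
      linarith
    refine aestronglyMeasurable_of_tendsto_ae (u := atTop)
      (f := fun (n : ℕ) a => slope (fun z => f z a) z₀ (z₀ + ((r / (n + 2) : ℝ) : ℂ)))
      (fun n => ?_) ?_
    · simp only [slope_def_field]
      have h1 : AEStronglyMeasurable
          (fun a => f (z₀ + ((r / (n + 2) : ℝ) : ℂ)) a - f z₀ a) μ :=
        (hmeas _ (hmem n)).sub (hmeas _ hz₀U)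
      simpa only [div_eq_mul_inv] using h1.mul_const _
    · filter_upwards [hderiv] with a ha
      exact (hasDerivAt_iff_tendsto_slope.1 (ha z₀ (Metric.mem_ball_self hr0))).comp hseq
  · filter_upwards [hdiff, hbound] with a ha hb z hz
    have hcl := (hsub z hz).trans hεU
    exact Complex.norm_deriv_le_of_forall_mem_sphere_norm_le hr0
      ((ha.mono (Metric.closure_ball_subset_closedBall.trans hcl)).diffContOnCl)
      fun w hw => hb w (hcl (Metric.sphere_subset_closedBall hw))

/-! ### Maclaurin coefficients -/

lemma maclaurinCoeff_congr {f g : ℂ → ℂ} (h : f =ᶠ[𝓝 0] g) (n : ℕ) :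
    maclaurinCoeff f n = maclaurinCoeff g n := by
  rw [maclaurinCoeff, maclaurinCoeff, h.iteratedDeriv_eq]

lemma maclaurinCoeff_add {f g : ℂ → ℂ} (hf : AnalyticAt ℂ f 0) (hg : AnalyticAt ℂ g 0) (n : ℕ) :
    maclaurinCoeff (fun s => f s + g s) n = maclaurinCoeff f n + maclaurinCoeff g n := by
  simp only [maclaurinCoeff]
  rw [iteratedDeriv_fun_add hf.contDiffAt hg.contDiffAt, add_div]

lemma maclaurinCoeff_sub {f g : ℂ → ℂ} (hf : AnalyticAt ℂ f 0) (hg : AnalyticAt ℂ g 0) (n : ℕ) :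
    maclaurinCoeff (fun s => f s - g s) n = maclaurinCoeff f n - maclaurinCoeff g n := by
  simp only [maclaurinCoeff]
  rw [iteratedDeriv_fun_sub hf.contDiffAt hg.contDiffAt, sub_div]

lemma maclaurinCoeff_mul_const (f : ℂ → ℂ) (c : ℂ) (n : ℕ) :
    maclaurinCoeff (fun s => f s * c) n = maclaurinCoeff f n * c := by
  simp only [maclaurinCoeff]
  rw [iteratedDeriv_mul_const_field]
  ring

lemma maclaurinCoeff_sum {ι : Type*} (t : Finset ι) {f : ι → ℂ → ℂ}
    (hf : ∀ i ∈ t, AnalyticAt ℂ (f i) 0) (n : ℕ) :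
    maclaurinCoeff (fun s => ∑ i ∈ t, f i s) n = ∑ i ∈ t, maclaurinCoeff (f i) n := by
  simp only [maclaurinCoeff]
  rw [iteratedDeriv_fun_sum fun i hi => (hf i hi).contDiffAt, Finset.sum_div]

lemma maclaurinCoeff_const (c : ℂ) (n : ℕ) :
    maclaurinCoeff (fun _ => c) n = if n = 0 then c else 0 := by
  rw [maclaurinCoeff, iteratedDeriv_const]
  split_ifs with h <;> simp [h]

lemma norm_maclaurinCoeff_le {f : ℂ → ℂ} {r C : ℝ} (hr : 0 < r)
    (hf : DiffContOnCl ℂ f (Metric.ball 0 r)) (hC : ∀ s ∈ Metric.sphere (0 : ℂ) r, ‖f s‖ ≤ C)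
    (n : ℕ) : ‖maclaurinCoeff f n‖ ≤ C / r ^ n := by
  have h := Complex.norm_iteratedDeriv_le_of_forall_mem_sphere_norm_le n hr hf hC
  have hn : (0 : ℝ) < (n ! : ℝ) := by exact_mod_cast n.factorial_pos
  rw [maclaurinCoeff, norm_div, Complex.norm_natCast, div_le_iff₀ hn]
  calc _ ≤ _ := h
    _ = _ := by ring

lemma differentiableAt_maclaurinCoeff {f : ℂ → ℂ → ℂ} {U : Set ℂ} {z₀ : ℂ} {r C : ℝ} (hr : 0 < r)
    (hU : U ∈ 𝓝 z₀) (hf : ∀ z ∈ U, DiffContOnCl ℂ (f z) (Metric.ball 0 r))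
    (hdiff : ∀ s ∈ Metric.sphere (0 : ℂ) r, DifferentiableOn ℂ (fun z => f z s) U)
    (hC : ∀ z ∈ U, ∀ s ∈ Metric.sphere (0 : ℂ) r, ‖f z s‖ ≤ C) (n : ℕ) :
    DifferentiableAt ℂ (fun z => maclaurinCoeff (f z) n) z₀ := by
  have hmem : ∀ θ : ℝ, circleMap 0 r θ ∈ Metric.sphere (0 : ℂ) r :=
    fun θ => circleMap_mem_sphere 0 hr.le θ
  have hne : ∀ θ : ℝ, circleMap 0 r θ ≠ 0 := fun θ => circleMap_ne_center hr.ne'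
  have key : DifferentiableAt ℂ
      (fun z => ∮ s in C(0, r), (1 / (s - 0) ^ (n + 1)) • f z s) z₀ := by
    simp only [circleIntegral_def_Icc]
    refine differentiableAt_integral_of_dominated (U := U)
      (bound := fun _ => r * (1 / r ^ (n + 1) * C)) hU ?_ ?_ ?_ ?_
    · intro z hz
      refine Continuous.aestronglyMeasurable ?_
      have hcont : Continuous fun θ => f z (circleMap 0 r θ) := by
        refine (hf z hz).continuousOn_ball.comp_continuous (continuous_circleMap 0 r) fun θ => ?_
        exact Metric.sphere_subset_closedBall (hmem θ)
      simp only [deriv_circleMap, sub_zero, smul_eq_mul]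
      refine ((continuous_circleMap 0 r).mul continuous_const).mul (Continuous.mul ?_ hcont)
      exact continuous_const.div ((continuous_circleMap 0 r).pow _) fun θ => pow_ne_zero _ (hne θ)
    · refine Eventually.of_forall fun θ => ?_
      simp only [smul_eq_mul]
      exact ((hdiff _ (hmem θ)).const_mul _).const_mul _
    · refine Eventually.of_forall fun θ z hz => ?_
      have h1 := hC z hz _ (hmem θ)
      simp only [deriv_circleMap, sub_zero, smul_eq_mul, norm_mul, norm_div, norm_pow, norm_one,
        Complex.norm_I, mul_one, norm_circleMap_zero, abs_of_pos hr]
      gcongr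
    · exact integrable_const _
  have heq : (fun z => maclaurinCoeff (f z) n) =ᶠ[𝓝 z₀] fun z =>
      (2 * Real.pi * Complex.I)⁻¹ * ∮ s in C(0, r), (1 / (s - 0) ^ (n + 1)) • f z s := by
    filter_upwards [hU] with z hz
    rw [(hf z hz).circleIntegral_one_div_sub_center_pow_smul hr n, maclaurinCoeff, smul_eq_mul]
    have := Complex.two_pi_I_ne_zero
    field_simp
  exact heq.differentiableAt_iff.2 (key.const_mul _)

/-- The Taylor expansion at `0` as a formal power series. -/
noncomputable def maclaurinSeries (f : ℂ → ℂ) : PowerSeries ℂ := PowerSeries.mk (maclaurinCoeff f)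

@[simp] lemma coeff_maclaurinSeries (f : ℂ → ℂ) (n : ℕ) :
    PowerSeries.coeff n (maclaurinSeries f) = maclaurinCoeff f n := by
  simp [maclaurinSeries]

lemma maclaurinSeries_mul {f g : ℂ → ℂ} (hf : AnalyticAt ℂ f 0) (hg : AnalyticAt ℂ g 0) :
    maclaurinSeries (fun s => f s * g s) = maclaurinSeries f * maclaurinSeries g := by
  ext n
  rw [PowerSeries.coeff_mul, coeff_maclaurinSeries, maclaurinCoeff,
    iteratedDeriv_fun_mul hf.contDiffAt hg.contDiffAt,
    Finset.Nat.sum_antidiagonal_eq_sum_range_succ_mk, Finset.sum_div]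
  refine Finset.sum_congr rfl fun i hi => ?_
  have hi' : i ≤ n := Nat.lt_succ_iff.1 (Finset.mem_range.1 hi)
  simp only [coeff_maclaurinSeries, maclaurinCoeff]
  rw [Nat.cast_choose ℂ hi']
  have h1 : (n ! : ℂ) ≠ 0 := by exact_mod_cast n.factorial_ne_zero
  field_simp

lemma maclaurinSeries_add {f g : ℂ → ℂ} (hf : AnalyticAt ℂ f 0) (hg : AnalyticAt ℂ g 0) :
    maclaurinSeries (fun s => f s + g s) = maclaurinSeries f + maclaurinSeries g := by
  ext n
  simp [maclaurinCoeff_add hf hg]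

lemma maclaurinSeries_sub {f g : ℂ → ℂ} (hf : AnalyticAt ℂ f 0) (hg : AnalyticAt ℂ g 0) :
    maclaurinSeries (fun s => f s - g s) = maclaurinSeries f - maclaurinSeries g := by
  ext n
  simp [maclaurinCoeff_sub hf hg]

lemma maclaurinSeries_congr {f g : ℂ → ℂ} (h : f =ᶠ[𝓝 0] g) :
    maclaurinSeries f = maclaurinSeries g := by
  ext n
  simp [maclaurinCoeff_congr h]

lemma maclaurinSeries_const (c : ℂ) : maclaurinSeries (fun _ => c) = PowerSeries.C c := by
  ext n
  rw [coeff_maclaurinSeries, maclaurinCoeff_const, PowerSeries.coeff_C]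

lemma maclaurinSeries_id : maclaurinSeries (fun s => s) = PowerSeries.X := by
  ext n
  rw [coeff_maclaurinSeries, maclaurinCoeff, iteratedDeriv_fun_id_zero, PowerSeries.coeff_X]
  split_ifs with h <;> simp [h]

lemma maclaurinSeries_exp_mul (c : ℂ) :
    maclaurinSeries (fun s => Complex.exp (c * s)) =
      PowerSeries.rescale c (PowerSeries.exp ℂ) := by
  ext n
  rw [coeff_maclaurinSeries, maclaurinCoeff, iteratedDeriv_cexp_const_mul,
    PowerSeries.coeff_rescale, PowerSeries.coeff_exp]
  simp [div_eq_mul_inv]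

lemma maclaurinCoeff_ascPochhammer (k n : ℕ) :
    maclaurinCoeff (fun s => (ascPochhammer ℂ k).eval s) n = Nat.stirlingFirst k n := by
  induction k generalizing n with
  | zero =>
    simp only [ascPochhammer_zero, Polynomial.eval_one, maclaurinCoeff_const]
    cases n <;> simp
  | succ k ih =>
    have h : maclaurinSeries (fun s => (ascPochhammer ℂ (k + 1)).eval s) =
        maclaurinSeries (fun s => (ascPochhammer ℂ k).eval s) *
          (PowerSeries.X + PowerSeries.C (k : ℂ)) := by
      have hp : AnalyticAt ℂ (fun s => (ascPochhammer ℂ k).eval s) 0 :=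
        (Polynomial.differentiable _).analyticAt 0
      rw [← maclaurinSeries_id, ← maclaurinSeries_const,
        ← maclaurinSeries_add (f := fun s => s) analyticAt_id analyticAt_const,
        ← maclaurinSeries_mul hp (by fun_prop)]
      congr 1
      funext s
      rw [ascPochhammer_succ_right]
      simp
    rw [← coeff_maclaurinSeries, h, mul_add, map_add, PowerSeries.coeff_mul_C]
    cases n with
    | zero =>
      rw [PowerSeries.coeff_zero_mul_X, coeff_maclaurinSeries, ih]
      cases k <;> simp
    | succ n =>
      rw [PowerSeries.coeff_succ_mul_X, coeff_maclaurinSeries, coeff_maclaurinSeries, ih, ih,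
        Nat.stirlingFirst_succ_succ]
      push_cast
      ring

lemma maclaurinCoeff_div_sub_one (x : ℂ) (n : ℕ) :
    maclaurinCoeff (fun s => x / (s - 1)) n = -x := by
  have hev : (fun s : ℂ => x / (s - 1) * (1 - s)) =ᶠ[𝓝 0] fun _ => -x := by
    filter_upwards [isOpen_ne.mem_nhds (zero_ne_one : (0 : ℂ) ≠ 1)] with s hs
    have : s - 1 ≠ 0 := sub_ne_zero.2 hs
    field_simp
    ring
  have hA : AnalyticAt ℂ (fun s : ℂ => x / (s - 1)) 0 :=
    analyticAt_const.div (by fun_prop) (by simp)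
  have h := maclaurinSeries_congr hev
  rw [maclaurinSeries_mul (g := fun s => 1 - s) hA (by fun_prop), maclaurinSeries_const,
    maclaurinSeries_sub (g := fun s => s) analyticAt_const analyticAt_id, maclaurinSeries_const,
    maclaurinSeries_id, map_one] at h
  have h2 : maclaurinSeries (fun s : ℂ => x / (s - 1)) =
      PowerSeries.C (-x) * PowerSeries.mk 1 := by
    rw [← h, mul_assoc, mul_comm (1 - PowerSeries.X), PowerSeries.mk_one_mul_one_sub_eq_one,
      mul_one]
  rw [← coeff_maclaurinSeries, h2, PowerSeries.coeff_C_mul]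
  simp

/-! ### The exponential generating function of the Bernoulli polynomials -/

/-- The entire function `(1 - exp (-u)) / u`. -/
noncomputable def expQuot : ℂ → ℂ := dslope (fun u => 1 - Complex.exp (-u)) 0

lemma expQuot_of_ne {u : ℂ} (hu : u ≠ 0) : expQuot u = (1 - Complex.exp (-u)) / u := by
  rw [expQuot, dslope_of_ne _ hu, slope_def_field]
  simp

lemma mul_expQuot (u : ℂ) : u * expQuot u = 1 - Complex.exp (-u) := by
  rcases eq_or_ne u 0 with rfl | hu
  · simp
  · rw [expQuot_of_ne hu]
    field_simp

lemma differentiable_expQuot : Differentiable ℂ expQuot := by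
  rw [← differentiableOn_univ, expQuot, Complex.differentiableOn_dslope univ_mem]
  fun_prop

lemma expQuot_zero : expQuot 0 = 1 := by
  have h : HasDerivAt (fun u : ℂ => 1 - Complex.exp (-u)) 1 0 := by
    have := ((hasDerivAt_neg (0 : ℂ)).cexp).const_sub 1
    simpa using this
  rw [expQuot, dslope_same, h.deriv]

/-- The horizontal strip of half-width `2 π`. -/
def strip : Set ℂ := {u | |u.im| < 2 * Real.pi}

lemma isOpen_strip : IsOpen strip :=
  isOpen_lt (by fun_prop) continuous_const

lemma zero_mem_strip : (0 : ℂ) ∈ strip := by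
  simp [strip, Real.pi_pos]

lemma strip_mem_nhds_zero : strip ∈ 𝓝 (0 : ℂ) := isOpen_strip.mem_nhds zero_mem_strip

lemma expQuot_ne_zero {u : ℂ} (hu : u ∈ strip) : expQuot u ≠ 0 := by
  rcases eq_or_ne u 0 with rfl | h0
  · simp [expQuot_zero]
  · intro h
    have h1 := mul_expQuot u
    rw [h, mul_zero] at h1
    have h2 : Complex.exp (-u) = 1 := (sub_eq_zero.1 h1.symm).symm
    obtain ⟨n, hn⟩ := Complex.exp_eq_one_iff.1 h2
    have him : u.im = -(n * (2 * Real.pi)) := by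
      have := congrArg Complex.im hn
      simp at this
      linarith
    have hs : |u.im| < 2 * Real.pi := hu
    rw [him, abs_neg, abs_mul, abs_of_pos Real.two_pi_pos] at hs
    have h3 : |(n : ℝ)| < 1 := by
      by_contra! h
      nlinarith [Real.two_pi_pos]
    have h4 : n = 0 := by
      have : |n| < 1 := by exact_mod_cast h3
      exact Int.abs_lt_one_iff.1 this
    rw [h4] at hn
    simp at hn
    exact h0 hn

/-- The generating function `∑ (-1) ^ n B_n(b) u ^ n / n!`. -/
noncomputable def bernoulliGen (b : ℝ) (u : ℂ) : ℂ := Complex.exp (-b * u) / expQuot u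

lemma differentiableOn_bernoulliGen (b : ℝ) : DifferentiableOn ℂ (bernoulliGen b) strip := by
  refine DifferentiableOn.div (by fun_prop) differentiable_expQuot.differentiableOn ?_
  exact fun u hu => expQuot_ne_zero hu

lemma maclaurinCoeff_bernoulliGen (b : ℝ) (n : ℕ) :
    maclaurinCoeff (bernoulliGen b) n =
      (-1) ^ n * ((Polynomial.aeval b (Polynomial.bernoulli n) / (n ! : ℝ) : ℝ) : ℂ) := by
  have hev : (fun u => bernoulliGen b u * (1 - Complex.exp (-1 * u))) =ᶠ[𝓝 0]
      fun u => u * Complex.exp (-b * u) := by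
    filter_upwards [strip_mem_nhds_zero] with u hu
    have := expQuot_ne_zero hu
    rw [neg_one_mul, ← mul_expQuot, bernoulliGen]
    field_simp
  have hA : AnalyticAt ℂ (bernoulliGen b) 0 :=
    (differentiableOn_bernoulliGen b).analyticAt strip_mem_nhds_zero
  have h := maclaurinSeries_congr hev
  have hexp : ∀ c : ℂ, AnalyticAt ℂ (fun u => Complex.exp (c * u)) 0 := fun c => by fun_prop
  rw [maclaurinSeries_mul (g := fun u => 1 - Complex.exp (-1 * u)) hA
      (analyticAt_const.sub (hexp _)),
    maclaurinSeries_sub analyticAt_const (hexp _), maclaurinSeries_const, map_one,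
    maclaurinSeries_mul (f := fun u => u) analyticAt_id (hexp _), maclaurinSeries_id,
    maclaurinSeries_exp_mul, maclaurinSeries_exp_mul] at h
  have hB := congrArg (PowerSeries.rescale (-1 : ℂ))
    (Polynomial.bernoulli_generating_function (b : ℂ))
  rw [map_mul, map_mul, map_sub, map_one, PowerSeries.rescale_rescale, mul_comm (b : ℂ),
    PowerSeries.rescale_neg_one_X, neg_one_mul] at hB
  have hne : (1 - PowerSeries.rescale (-1 : ℂ) (PowerSeries.exp ℂ)) ≠ 0 := by
    intro h0
    have := congrArg (PowerSeries.coeff 1) h0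
    simp [PowerSeries.coeff_exp, PowerSeries.coeff_one] at this
  have key : maclaurinSeries (bernoulliGen b) = PowerSeries.rescale (-1 : ℂ)
      (PowerSeries.mk fun n => Polynomial.aeval (b : ℂ)
        ((1 / n ! : ℚ) • Polynomial.bernoulli n)) := by
    refine mul_right_cancel₀ hne ?_
    rw [h]
    linear_combination hB
  rw [← coeff_maclaurinSeries, key, PowerSeries.coeff_rescale, PowerSeries.coeff_mk, map_smul]
  have hcast : Polynomial.aeval (b : ℂ) (Polynomial.bernoulli n) =
      ((Polynomial.aeval b (Polynomial.bernoulli n) : ℝ) : ℂ) :=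
    Polynomial.aeval_algebraMap_apply ℂ b _
  rw [hcast, Algebra.smul_def]
  push_cast
  simp only [one_div]
  ring

/-- The function `exp (-b u) / (1 - exp (-u)) - 1 / u`, without its singularity at `0`. -/
noncomputable def kernelFun (b : ℝ) : ℂ → ℂ := dslope (bernoulliGen b) 0

lemma differentiableOn_kernelFun (b : ℝ) : DifferentiableOn ℂ (kernelFun b) strip :=
  (Complex.differentiableOn_dslope strip_mem_nhds_zero).2 (differentiableOn_bernoulliGen b)

lemma bernoulliGen_zero (b : ℝ) : bernoulliGen b 0 = 1 := by
  simp [bernoulliGen, expQuot_zero]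

lemma kernelFun_of_ne (b : ℝ) {u : ℂ} (hu : u ≠ 0) :
    kernelFun b u = Complex.exp (-b * u) / (1 - Complex.exp (-u)) - 1 / u := by
  rw [kernelFun, dslope_of_ne _ hu, slope_def_field, bernoulliGen_zero, bernoulliGen,
    expQuot_of_ne hu]
  field_simp
  simp only [sub_zero]
  ring

lemma maclaurinCoeff_kernelFun (b : ℝ) (k : ℕ) :
    maclaurinCoeff (kernelFun b) k = (-1) ^ (k + 1) *
      ((Polynomial.aeval b (Polynomial.bernoulli (k + 1)) / ((k + 1)! : ℝ) : ℝ) : ℂ) := by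
  have hfun : bernoulliGen b = fun u => 1 + kernelFun b u * u := by
    funext u
    rcases eq_or_ne u 0 with rfl | hu
    · simp [bernoulliGen_zero]
    · rw [kernelFun, dslope_of_ne _ hu, slope_def_field, bernoulliGen_zero]
      field_simp
      ring
  have hA : AnalyticAt ℂ (kernelFun b) 0 :=
    (differentiableOn_kernelFun b).analyticAt strip_mem_nhds_zero
  have h : maclaurinSeries (bernoulliGen b) =
      PowerSeries.C 1 + maclaurinSeries (kernelFun b) * PowerSeries.X := by
    conv_lhs => rw [hfun]
    rw [maclaurinSeries_add (g := fun u => kernelFun b u * u) analyticAt_const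
      (hA.mul analyticAt_id), maclaurinSeries_mul (g := fun u => u) hA analyticAt_id,
      maclaurinSeries_id, maclaurinSeries_const]
  have h2 := congrArg (PowerSeries.coeff (k + 1)) h
  rw [map_add, PowerSeries.coeff_succ_mul_X, PowerSeries.coeff_C, if_neg k.succ_ne_zero, zero_add,
    coeff_maclaurinSeries, coeff_maclaurinSeries, maclaurinCoeff_bernoulliGen] at h2
  exact h2.symm

/-! ### Bounds in half-strips -/

/-- The exponential type of the kernel on the positive axis. -/
noncomputable def kernelType (b : ℝ) : ℝ := max 0 (-b)

lemma kernelType_nonneg (b : ℝ) : 0 ≤ kernelType b := le_max_left _ _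

lemma neg_le_kernelType (b : ℝ) : -b ≤ kernelType b := le_max_right _ _

lemma kernelType_lt_one {b : ℝ} (hb : -1 < b) : kernelType b < 1 :=
  max_lt one_pos (by linarith)

lemma exists_norm_kernelFun_le (b : ℝ) {ρ : ℝ} (hρ : ρ < 2 * Real.pi) :
    ∃ C : ℝ, 0 < C ∧ ∀ u : ℂ, |u.im| ≤ ρ → -ρ ≤ u.re →
      ‖kernelFun b u‖ ≤ C * Real.exp (kernelType b * u.re) := by
  set β := kernelType b with hβ
  have hβ0 : 0 ≤ β := kernelType_nonneg b
  have hcomp : IsCompact (Icc (-ρ) 1 ×ℂ Icc (-ρ) ρ) := isCompact_Icc.reProdIm isCompact_Icc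
  have hsub : Icc (-ρ) 1 ×ℂ Icc (-ρ) ρ ⊆ strip := by
    intro u hu
    have h2 := (Complex.mem_reProdIm.1 hu).2
    exact (abs_le.2 ⟨h2.1, h2.2⟩).trans_lt hρ
  obtain ⟨M, hM⟩ := hcomp.exists_bound_of_continuousOn
    ((differentiableOn_kernelFun b).continuousOn.mono hsub)
  set D := 1 / (1 - Real.exp (-1)) + 1 with hD
  have he : 0 < 1 - Real.exp (-1) := by
    have : Real.exp (-1) < 1 := by simp
    linarith
  have hD0 : 0 < D := by positivity
  refine ⟨|M| * Real.exp (β * |ρ|) + D, by positivity, fun u him hre => ?_⟩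
  have hE := Real.exp_pos (β * u.re)
  rcases le_or_gt u.re 1 with h1 | h1
  · have hmem : u ∈ Icc (-ρ) 1 ×ℂ Icc (-ρ) ρ :=
      Complex.mem_reProdIm.2 ⟨⟨hre, h1⟩, abs_le.1 him⟩
    have h2 : 1 ≤ Real.exp (β * |ρ|) * Real.exp (β * u.re) := by
      rw [← Real.exp_add, ← mul_add]
      refine Real.one_le_exp (mul_nonneg hβ0 ?_)
      linarith [le_abs_self ρ]
    calc ‖kernelFun b u‖ ≤ M := hM u hmem
      _ ≤ |M| * 1 := by rw [mul_one]; exact le_abs_self M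
      _ ≤ |M| * (Real.exp (β * |ρ|) * Real.exp (β * u.re)) := by gcongr
      _ ≤ _ := by
        rw [add_mul, mul_assoc]
        exact le_add_of_nonneg_right (by positivity)
  · have hu0 : u ≠ 0 := by
      rintro rfl
      simp at h1
      linarith
    have hn : 1 ≤ ‖u‖ := h1.le.trans (Complex.re_le_norm u)
    have h3 : 1 - Real.exp (-1) ≤ ‖1 - Complex.exp (-u)‖ := by
      have h4 := norm_sub_norm_le (1 : ℂ) (Complex.exp (-u))
      rw [norm_one, Complex.norm_exp] at h4
      have h5 : Real.exp ((-u).re) ≤ Real.exp (-1) := by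
        apply Real.exp_le_exp.2
        simp
        exact h1.le
      linarith
    have h6 : ‖Complex.exp (-b * u)‖ ≤ Real.exp (β * u.re) := by
      rw [Complex.norm_exp]
      apply Real.exp_le_exp.2
      have : (-(b : ℂ) * u).re = -b * u.re := by simp
      rw [this]
      exact mul_le_mul_of_nonneg_right (neg_le_kernelType b) (by linarith)
    have h7 : 1 ≤ Real.exp (β * u.re) := Real.one_le_exp (mul_nonneg hβ0 (by linarith))
    rw [kernelFun_of_ne b hu0]
    calc _ ≤ ‖Complex.exp (-b * u) / (1 - Complex.exp (-u))‖ + ‖1 / u‖ := norm_sub_le _ _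
      _ ≤ Real.exp (β * u.re) / (1 - Real.exp (-1)) + Real.exp (β * u.re) := by
        rw [norm_div, norm_div, norm_one]
        refine add_le_add (by gcongr) ?_
        exact ((div_le_one (by linarith)).2 hn).trans h7
      _ = D * Real.exp (β * u.re) := by rw [hD]; ring
      _ ≤ _ := by
        gcongr
        exact le_add_of_nonneg_left (by positivity)

lemma ofReal_mem_strip (v : ℝ) : (v : ℂ) ∈ strip := by
  simp [strip, Real.pi_pos]

lemma exists_norm_iteratedDeriv_kernelFun_le (b : ℝ) {ρ : ℝ} (hρ0 : 0 < ρ)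
    (hρ : ρ < 2 * Real.pi) : ∃ C : ℝ, 0 < C ∧ ∀ (K : ℕ) (v : ℝ), 0 ≤ v →
      ‖iteratedDeriv K (kernelFun b) v‖ ≤ C * (K ! : ℝ) / ρ ^ K * Real.exp (kernelType b * v) := by
  obtain ⟨C, hC, h⟩ := exists_norm_kernelFun_le b hρ
  refine ⟨C * Real.exp (kernelType b * ρ), by positivity, fun K v hv => ?_⟩
  have habs : ∀ u ∈ Metric.closedBall (v : ℂ) ρ, |u.im| ≤ ρ ∧ |u.re - v| ≤ ρ := by
    intro u hu
    rw [mem_closedBall_iff_norm] at hu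
    have h1 := (Complex.abs_im_le_norm (u - v)).trans hu
    have h2 := (Complex.abs_re_le_norm (u - v)).trans hu
    simp only [Complex.sub_im, Complex.sub_re, Complex.ofReal_im, Complex.ofReal_re,
      sub_zero] at h1 h2
    exact ⟨h1, h2⟩
  have hsub : closure (Metric.ball (v : ℂ) ρ) ⊆ strip := fun u hu =>
    (habs u (Metric.closure_ball_subset_closedBall hu)).1.trans_lt hρ
  have key := Complex.norm_iteratedDeriv_le_of_forall_mem_sphere_norm_le
    (C := C * Real.exp (kernelType b * (v + ρ))) K hρ0
    ((differentiableOn_kernelFun b).mono hsub).diffContOnCl fun u hu => by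
      obtain ⟨h1, h2⟩ := habs u (Metric.sphere_subset_closedBall hu)
      have h3 := abs_le.1 h2
      refine (h u h1 (by linarith)).trans ?_
      have := kernelType_nonneg b
      gcongr
      linarith
  refine key.trans (le_of_eq ?_)
  rw [mul_add, Real.exp_add]
  ring

lemma differentiableOn_iteratedDeriv_kernelFun (b : ℝ) (K : ℕ) :
    DifferentiableOn ℂ (iteratedDeriv K (kernelFun b)) strip := by
  induction K with
  | zero => simpa using differentiableOn_kernelFun b
  | succ K ih =>
    rw [iteratedDeriv_succ]
    exact ih.deriv isOpen_strip

lemma hasDerivAt_iteratedDeriv_kernelFun (b : ℝ) (K : ℕ) (v : ℝ) :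
    HasDerivAt (fun v : ℝ => iteratedDeriv K (kernelFun b) v)
      (iteratedDeriv (K + 1) (kernelFun b) v) v := by
  have h := ((differentiableOn_iteratedDeriv_kernelFun b K).differentiableAt
    (isOpen_strip.mem_nhds (ofReal_mem_strip v))).hasDerivAt
  rw [← iteratedDeriv_succ] at h
  exact h.comp_ofReal

lemma continuous_iteratedDeriv_kernelFun (b : ℝ) (K : ℕ) :
    Continuous fun v : ℝ => iteratedDeriv K (kernelFun b) v :=
  continuous_iff_continuousAt.2 fun v => (hasDerivAt_iteratedDeriv_kernelFun b K v).continuousAt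

lemma exists_norm_kernelFun_sub_le (b : ℝ) : ∃ C : ℝ, 0 < C ∧ ∀ v : ℝ, 0 ≤ v →
    ‖kernelFun b v - kernelFun b 0‖ ≤ C * v * Real.exp (kernelType b * v) := by
  obtain ⟨C, hC, h⟩ := exists_norm_iteratedDeriv_kernelFun_le b one_pos
    (by linarith [Real.pi_gt_three])
  refine ⟨C, hC, fun v hv => ?_⟩
  have hd : ∀ x ∈ Icc 0 v, HasDerivWithinAt (fun v : ℝ => kernelFun b v)
      (iteratedDeriv 1 (kernelFun b) x) (Icc 0 v) x := fun x _ => by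
    have := (hasDerivAt_iteratedDeriv_kernelFun b 0 x).hasDerivWithinAt (s := Icc 0 v)
    simpa using this
  have hb : ∀ x ∈ Ico 0 v, ‖iteratedDeriv 1 (kernelFun b) x‖ ≤
      C * Real.exp (kernelType b * v) := fun x hx => by
    refine (h 1 x hx.1).trans ?_
    have h1 := kernelType_nonneg b
    have h2 := hx.2.le
    simp only [Nat.factorial_one, Nat.cast_one, mul_one, pow_one, div_one]
    gcongr
  have := norm_image_sub_le_of_norm_deriv_le_segment' hd hb v ⟨hv, le_rfl⟩
  simp only [sub_zero, Complex.ofReal_zero] at this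
  calc _ ≤ _ := this
    _ = _ := by ring

section

/-! ### Laplace transforms -/

/-- The Laplace transform of `f` on the positive half-line. -/
noncomputable def laplace (f : ℝ → ℂ) (y : ℂ) : ℂ := ∫ v in Ioi (0 : ℝ), f v * Complex.exp (-y * v)

section laplace

variable {f f' : ℝ → ℂ} {β M : ℝ} {y : ℂ}

lemma norm_mul_exp_le (hM : ∀ v, 0 ≤ v → ‖f v‖ ≤ M * Real.exp (β * v)) {v : ℝ} (hv : 0 ≤ v) :
    ‖f v * Complex.exp (-y * v)‖ ≤ M * Real.exp ((β - y.re) * v) := by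
  rw [norm_mul, Complex.norm_exp]
  have h : (-y * (v : ℂ)).re = -y.re * v := by simp
  rw [h, sub_mul, Real.exp_sub, mul_div_assoc', neg_mul, Real.exp_neg, ← div_eq_mul_inv]
  gcongr
  exact hM v hv

lemma integrableOn_laplace (hf : Continuous f) (hM : ∀ v, 0 ≤ v → ‖f v‖ ≤ M * Real.exp (β * v))
    (hy : β < y.re) : IntegrableOn (fun v : ℝ => f v * Complex.exp (-y * v)) (Ioi 0) := by
  refine Integrable.mono' ((integrableOn_exp_mul_Ioi (a := β - y.re) (by linarith) 0).const_mul M)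
    (by fun_prop) ?_
  filter_upwards [ae_restrict_mem measurableSet_Ioi] with v hv
  exact norm_mul_exp_le hM (le_of_lt hv)

lemma norm_laplace_le (hM : ∀ v, 0 ≤ v → ‖f v‖ ≤ M * Real.exp (β * v)) (hy : β < y.re) :
    ‖laplace f y‖ ≤ M / (y.re - β) := by
  have hint := (integrableOn_exp_mul_Ioi (a := β - y.re) (by linarith) 0).const_mul M
  calc ‖laplace f y‖ ≤ ∫ v in Ioi (0 : ℝ), M * Real.exp ((β - y.re) * v) := by
        refine norm_integral_le_of_norm_le hint ?_
        filter_upwards [ae_restrict_mem measurableSet_Ioi] with v hv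
        exact norm_mul_exp_le hM (le_of_lt hv)
    _ = M / (y.re - β) := by
        rw [integral_const_mul, integral_exp_mul_Ioi (by linarith), mul_zero, Real.exp_zero,
          neg_div, ← div_neg, neg_sub]
        ring

lemma differentiableAt_laplace (hf : Continuous f)
    (hM : ∀ v, 0 ≤ v → ‖f v‖ ≤ M * Real.exp (β * v)) (hy : β < y.re) :
    DifferentiableAt ℂ (laplace f) y := by
  have hopen : IsOpen {z : ℂ | (β + y.re) / 2 < z.re} := isOpen_lt continuous_const (by fun_prop)
  refine differentiableAt_integral_of_dominated
    (bound := fun v => M * Real.exp ((β - (β + y.re) / 2) * v))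
    (hopen.mem_nhds (show (β + y.re) / 2 < y.re by linarith)) ?_ ?_ ?_ ?_
  · intro z _
    exact Continuous.aestronglyMeasurable (by fun_prop)
  · exact Eventually.of_forall fun v => by fun_prop
  · filter_upwards [ae_restrict_mem measurableSet_Ioi] with v hv z hz
    refine (norm_mul_exp_le hM (le_of_lt hv)).trans ?_
    have hM0 : 0 ≤ M := by
      have := (norm_nonneg _).trans (hM 0 le_rfl)
      simpa using this
    have hv' : 0 ≤ v := le_of_lt hv
    have hz' : (β + y.re) / 2 ≤ z.re := le_of_lt hz
    gcongr
  · exact (integrableOn_exp_mul_Ioi (by linarith) 0).const_mul M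

lemma laplace_eq_add (hf : ∀ v, HasDerivAt f (f' v) v) (hf' : Continuous f')
    (hM : ∀ v, 0 ≤ v → ‖f v‖ ≤ M * Real.exp (β * v)) {M' : ℝ}
    (hM' : ∀ v, 0 ≤ v → ‖f' v‖ ≤ M' * Real.exp (β * v)) (hy : β < y.re) (hy0 : y ≠ 0) :
    laplace f y = f 0 / y + laplace f' y / y := by
  have hcont : Continuous f := continuous_iff_continuousAt.2 fun v => (hf v).continuousAt
  have hd : ∀ v ∈ Ici (0 : ℝ), HasDerivAt (fun v : ℝ => f v * Complex.exp (-y * v))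
      (f' v * Complex.exp (-y * v) - y * (f v * Complex.exp (-y * v))) v := fun v _ => by
    have h1 : HasDerivAt (fun v : ℝ => Complex.exp (-y * v)) (Complex.exp (-y * v) * (-y)) v := by
      have h2 : HasDerivAt (fun v : ℂ => -y * v) (-y) (v : ℂ) := by
        simpa using (hasDerivAt_id (v : ℂ)).const_mul (-y)
      exact h2.cexp.comp_ofReal
    refine ((hf v).mul h1).congr_deriv ?_
    ring
  have hint := integrableOn_laplace hcont hM hy
  have hint' := integrableOn_laplace hf' hM' hy
  have hlim : Tendsto (fun v : ℝ => f v * Complex.exp (-y * v)) atTop (𝓝 0) := by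
    refine squeeze_zero_norm' (a := fun v => M * Real.exp ((β - y.re) * v)) ?_ ?_
    · filter_upwards [eventually_ge_atTop 0] with v hv using norm_mul_exp_le hM hv
    · have : Tendsto (fun v : ℝ => (β - y.re) * v) atTop atBot :=
        tendsto_id.const_mul_atTop_of_neg (by linarith)
      simpa using (Real.tendsto_exp_atBot.comp this).const_mul M
  have key := integral_Ioi_of_hasDerivAt_of_tendsto' hd (hint'.sub (hint.const_mul y)) hlim
  rw [integral_sub hint' (hint.const_mul y), integral_const_mul] at key
  change laplace f' y - y * laplace f y = _ at key
  simp only [Complex.ofReal_zero, mul_zero, Complex.exp_zero, mul_one, zero_sub] at key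
  field_simp
  linear_combination -key

end laplace

/-! ### The Laplace transform of the kernel and its asymptotic expansion -/

/-- The remainder after `K` terms in the expansion of the Laplace transform of the kernel. -/
noncomputable def laplaceRem (b : ℝ) (K : ℕ) (y : ℂ) : ℂ :=
  laplace (fun v => iteratedDeriv K (kernelFun b) v) y / y ^ K

variable {b : ℝ}

lemma ne_zero_of_kernelType_lt {y : ℂ} (hy : kernelType b < y.re) : y ≠ 0 := by
  rintro rfl
  simp at hy
  linarith [kernelType_nonneg b]

lemma laplaceRem_succ (K : ℕ) {y : ℂ} (hy : kernelType b < y.re) :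
    laplaceRem b K y = iteratedDeriv K (kernelFun b) 0 / y ^ (K + 1) + laplaceRem b (K + 1) y := by
  obtain ⟨C, -, hC⟩ := exists_norm_iteratedDeriv_kernelFun_le b one_pos
    (by linarith [Real.pi_gt_three])
  have hy0 := ne_zero_of_kernelType_lt hy
  rw [laplaceRem, laplaceRem, laplace_eq_add (hasDerivAt_iteratedDeriv_kernelFun b K)
    (continuous_iteratedDeriv_kernelFun b (K + 1)) (hC K) (hC (K + 1)) hy hy0]
  simp only [Complex.ofReal_zero]
  field_simp
  ring

lemma differentiableAt_laplaceRem (K : ℕ) {y : ℂ} (hy : kernelType b < y.re) :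
    DifferentiableAt ℂ (laplaceRem b K) y := by
  obtain ⟨C, -, hC⟩ := exists_norm_iteratedDeriv_kernelFun_le b one_pos
    (by linarith [Real.pi_gt_three])
  exact (differentiableAt_laplace (continuous_iteratedDeriv_kernelFun b K) (hC K) hy).div
    (by fun_prop) (pow_ne_zero _ (ne_zero_of_kernelType_lt hy))

lemma exists_norm_laplaceRem_le {σ ρ : ℝ} (hσ : kernelType b < σ) (hρ0 : 0 < ρ)
    (hρ : ρ < 2 * Real.pi) : ∃ C : ℝ, 0 < C ∧ ∀ (K : ℕ) (y : ℂ), σ ≤ y.re →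
      ‖laplaceRem b K y‖ ≤ C * (K ! : ℝ) / ρ ^ K / ‖y‖ ^ (K + 1) := by
  obtain ⟨τ, hτ, hτ'⟩ := exists_between hρ
  have hτ0 : 0 < τ := hρ0.trans hτ
  obtain ⟨C₁, hC₁, h₁⟩ := exists_norm_iteratedDeriv_kernelFun_le b hρ0 hρ
  obtain ⟨C₂, hC₂, h₂⟩ := exists_norm_iteratedDeriv_kernelFun_le b hτ0 hτ'
  set t := τ / ρ - 1 with ht
  have ht0 : 0 < t := by
    rw [ht, sub_pos, one_lt_div hρ0]
    exact hτ
  have hlin : ∀ K : ℕ, ((K : ℝ) + 1) / τ ^ K ≤ (1 + 1 / t) / ρ ^ K := by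
    intro K
    have h := one_add_mul_le_pow (show (-2 : ℝ) ≤ t by linarith) K
    have h3 : 1 + t = τ / ρ := by rw [ht]; ring
    rw [h3, div_pow] at h
    have h4 : (K : ℝ) + 1 ≤ (1 + 1 / t) * (1 + K * t) := by
      have h5 : (1 + 1 / t) * (1 + K * t) = K + 1 + K * t + 1 / t := by
        field_simp
        ring
      rw [h5]
      have : 0 ≤ K * t + 1 / t := by positivity
      linarith
    rw [div_le_div_iff₀ (by positivity) (by positivity)]
    calc ((K : ℝ) + 1) * ρ ^ K ≤ (1 + 1 / t) * (1 + K * t) * ρ ^ K := by gcongr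
      _ ≤ (1 + 1 / t) * (τ ^ K / ρ ^ K) * ρ ^ K := by gcongr
      _ = (1 + 1 / t) * τ ^ K := by field_simp
  have hσ' : 0 < σ - kernelType b := sub_pos.2 hσ
  refine ⟨C₁ + C₂ / τ / (σ - kernelType b) * (1 + 1 / t), by positivity, fun K y hy => ?_⟩
  have hyβ : kernelType b < y.re := hσ.trans_le hy
  have hy0 := ne_zero_of_kernelType_lt hyβ
  have hn : 0 < ‖y‖ := norm_pos_iff.2 hy0
  have hA : ‖iteratedDeriv K (kernelFun b) 0‖ ≤ C₁ * (K ! : ℝ) / ρ ^ K := by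
    simpa using h₁ K 0 le_rfl
  have hB : ‖laplace (fun v => iteratedDeriv (K + 1) (kernelFun b) v) y‖ ≤
      C₂ / τ / (σ - kernelType b) * (1 + 1 / t) * (K ! : ℝ) / ρ ^ K := by
    calc _ ≤ C₂ * ((K + 1)! : ℝ) / τ ^ (K + 1) / (y.re - kernelType b) :=
          norm_laplace_le (h₂ (K + 1)) hyβ
      _ ≤ C₂ * ((K + 1)! : ℝ) / τ ^ (K + 1) / (σ - kernelType b) := by gcongr
      _ = C₂ / τ / (σ - kernelType b) * (K ! : ℝ) * (((K : ℝ) + 1) / τ ^ K) := by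
          rw [Nat.factorial_succ]
          push_cast
          field_simp
          ring
      _ ≤ C₂ / τ / (σ - kernelType b) * (K ! : ℝ) * ((1 + 1 / t) / ρ ^ K) :=
          mul_le_mul_of_nonneg_left (hlin K) (by positivity)
      _ = _ := by ring
  rw [laplaceRem_succ K hyβ, laplaceRem, ← add_div, norm_div, norm_pow]
  gcongr
  calc _ ≤ _ := norm_add_le _ _
    _ ≤ _ := add_le_add hA hB
    _ = _ := by ring

/-! ### Weighted integrals over the half-line -/

/-- An integrable majorant on `(0, ∞)` of `w ^ (-s) (1 + w) ^ (-2)` for `|Re s| ≤ r < 1`. -/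
noncomputable def weight (r w : ℝ) : ℝ := (w ^ (-r) + w ^ r) / (1 + w) ^ 2

lemma integrableOn_weight {r : ℝ} (hr0 : 0 ≤ r) (hr : r < 1) :
    IntegrableOn (weight r) (Ioi 0) := by
  have hmeas : Measurable (weight r) := by
    unfold weight
    fun_prop
  rw [← Ioc_union_Ioi_eq_Ioi zero_le_one]
  refine IntegrableOn.union ?_ ?_
  · have h1 : IntegrableOn (fun w : ℝ => w ^ (-r) * 2) (Ioc 0 1) := by
      have := intervalIntegral.intervalIntegrable_rpow' (a := 0) (b := 1) (r := -r) (by linarith)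
      exact ((intervalIntegrable_iff_integrableOn_Ioc_of_le zero_le_one).1 this).mul_const 2
    refine Integrable.mono' h1 hmeas.aestronglyMeasurable ?_
    filter_upwards [ae_restrict_mem measurableSet_Ioc] with w hw
    have hw0 : 0 < w := hw.1
    have h2 : w ^ r ≤ w ^ (-r) := Real.rpow_le_rpow_of_exponent_ge hw0 hw.2 (by linarith)
    rw [weight, Real.norm_of_nonneg (by positivity)]
    calc _ ≤ (w ^ (-r) + w ^ r) / 1 := by
          gcongr
          nlinarith
      _ ≤ _ := by linarith
  · have h1 : IntegrableOn (fun w : ℝ => w ^ (r - 2) * 2) (Ioi 1) :=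
      (integrableOn_Ioi_rpow_of_lt (by linarith) one_pos).mul_const 2
    refine Integrable.mono' h1 hmeas.aestronglyMeasurable ?_
    filter_upwards [ae_restrict_mem measurableSet_Ioi] with w hw
    have hw1 : 1 < w := hw
    have hw0 : 0 < w := one_pos.trans hw1
    have h2 : w ^ (-r) ≤ w ^ r := Real.rpow_le_rpow_of_exponent_le hw1.le (by linarith)
    rw [weight, Real.norm_of_nonneg (by positivity), Real.rpow_sub hw0, Real.rpow_two]
    calc _ ≤ (w ^ r + w ^ r) / w ^ 2 := by
          gcongr
          linarith
      _ = _ := by ring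

lemma norm_cpow_neg_le {r w : ℝ} (hw : 0 < w) {s : ℂ} (hs : |s.re| ≤ r) :
    ‖(w : ℂ) ^ (-s)‖ ≤ w ^ (-r) + w ^ r := by
  obtain ⟨h1, h2⟩ := abs_le.1 hs
  rw [Complex.norm_cpow_eq_rpow_re_of_pos hw, Complex.neg_re]
  have ha : 0 < w ^ (-r) := Real.rpow_pos_of_pos hw _
  have hb : 0 < w ^ r := Real.rpow_pos_of_pos hw _
  rcases le_total w 1 with hw1 | hw1
  · have := Real.rpow_le_rpow_of_exponent_ge hw hw1 (show -r ≤ -s.re by linarith)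
    linarith
  · have := Real.rpow_le_rpow_of_exponent_le hw1 (show -s.re ≤ r by linarith)
    linarith

lemma integral_weight_nonneg (r : ℝ) : 0 ≤ ∫ w in Ioi (0 : ℝ), weight r w := by
  refine setIntegral_nonneg measurableSet_Ioi fun w hw => ?_
  have hw' : 0 < w := hw
  unfold weight
  positivity

/-- The integral `∫ w ^ (-s) h(z (1 + w)) dw` over the half-line. -/
noncomputable def stieltjes (h : ℂ → ℂ) (s z : ℂ) : ℂ :=
  ∫ w in Ioi (0 : ℝ), (w : ℂ) ^ (-s) * h (z * (1 + w))

section stieltjes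

variable {h : ℂ → ℂ} {β M r : ℝ} {s z : ℂ}

lemma lt_re_mul_one_add (hβ : 0 ≤ β) (hz : β < z.re) {w : ℝ} (hw : 0 < w) :
    β < (z * (1 + w)).re := by
  have : (z * (1 + (w : ℂ))).re = z.re * (1 + w) := by simp
  rw [this]
  nlinarith

lemma norm_mul_one_add {w : ℝ} (hw : 0 < w) : ‖z * (1 + (w : ℂ))‖ = ‖z‖ * (1 + w) := by
  rw [norm_mul]
  congr 1
  rw [show (1 + (w : ℂ)) = ((1 + w : ℝ) : ℂ) by push_cast; rfl, Complex.norm_real,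
    Real.norm_of_nonneg (by positivity)]

lemma norm_stieltjes_integrand_le (hM : ∀ w : ℝ, 0 < w → ‖h (z * (1 + w))‖ ≤ M / (1 + w) ^ 2)
    (hs : |s.re| ≤ r) {w : ℝ} (hw : 0 < w) :
    ‖(w : ℂ) ^ (-s) * h (z * (1 + w))‖ ≤ M * weight r w := by
  have h1 := norm_cpow_neg_le hw hs
  have h2 := hM w hw
  have h3 : 0 ≤ w ^ (-r) + w ^ r := (norm_nonneg _).trans h1
  rw [norm_mul, weight]
  calc _ ≤ (w ^ (-r) + w ^ r) * (M / (1 + w) ^ 2) := by gcongr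
    _ = _ := by ring

lemma aestronglyMeasurable_stieltjes (hβ : 0 ≤ β) (hh : ∀ y : ℂ, β < y.re → DifferentiableAt ℂ h y)
    (hz : β < z.re) : AEStronglyMeasurable (fun w : ℝ => (w : ℂ) ^ (-s) * h (z * (1 + w)))
      (volume.restrict (Ioi 0)) := by
  refine ContinuousOn.aestronglyMeasurable (fun w hw => ?_) measurableSet_Ioi
  have hw0 : 0 < w := hw
  refine ContinuousAt.continuousWithinAt (ContinuousAt.mul ?_ ?_)
  · exact Complex.continuousAt_ofReal_cpow_const w _ (Or.inr hw0.ne')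
  · exact ContinuousAt.comp (f := fun w : ℝ => z * (1 + (w : ℂ)))
      (hh _ (lt_re_mul_one_add hβ hz hw0)).continuousAt (by fun_prop)

lemma integrableOn_stieltjes (hβ : 0 ≤ β) (hh : ∀ y : ℂ, β < y.re → DifferentiableAt ℂ h y)
    (hz : β < z.re) (hM : ∀ w : ℝ, 0 < w → ‖h (z * (1 + w))‖ ≤ M / (1 + w) ^ 2)
    (hs : |s.re| < 1) :
    IntegrableOn (fun w : ℝ => (w : ℂ) ^ (-s) * h (z * (1 + w))) (Ioi 0) := by
  refine Integrable.mono' ((integrableOn_weight (abs_nonneg _) hs).const_mul M)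
    (aestronglyMeasurable_stieltjes hβ hh hz) ?_
  filter_upwards [ae_restrict_mem measurableSet_Ioi] with w hw
  exact norm_stieltjes_integrand_le hM le_rfl hw

lemma norm_stieltjes_le (hM : ∀ w : ℝ, 0 < w → ‖h (z * (1 + w))‖ ≤ M / (1 + w) ^ 2)
    (hr : r < 1) (hs : |s.re| ≤ r) :
    ‖stieltjes h s z‖ ≤ M * ∫ w in Ioi (0 : ℝ), weight r w := by
  rw [← integral_const_mul]
  refine norm_integral_le_of_norm_le
    ((integrableOn_weight ((abs_nonneg _).trans hs) hr).const_mul M) ?_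
  filter_upwards [ae_restrict_mem measurableSet_Ioi] with w hw
  exact norm_stieltjes_integrand_le hM hs hw

lemma differentiableAt_stieltjes_left (hβ : 0 ≤ β)
    (hh : ∀ y : ℂ, β < y.re → DifferentiableAt ℂ h y)
    (hz : β < z.re) (hM : ∀ w : ℝ, 0 < w → ‖h (z * (1 + w))‖ ≤ M / (1 + w) ^ 2)
    (hs : |s.re| < 1) : DifferentiableAt ℂ (fun s => stieltjes h s z) s := by
  obtain ⟨r, hr, hr1⟩ := exists_between hs
  have hopen : IsOpen {t : ℂ | |t.re| < r} := isOpen_lt (by fun_prop) continuous_const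
  refine differentiableAt_integral_of_dominated (bound := fun w => M * weight r w)
    (hopen.mem_nhds hr) (fun t _ => aestronglyMeasurable_stieltjes hβ hh hz) ?_ ?_
    ((integrableOn_weight ((abs_nonneg _).trans hr.le) hr1).const_mul M)
  · filter_upwards [ae_restrict_mem measurableSet_Ioi] with w hw
    have hw0 : (w : ℂ) ≠ 0 := by exact_mod_cast (ne_of_gt hw)
    intro t _
    refine (DifferentiableAt.mul ?_ (differentiableAt_const _)).differentiableWithinAt
    exact differentiableAt_id.neg.const_cpow (Or.inl hw0)
  · filter_upwards [ae_restrict_mem measurableSet_Ioi] with w hw t ht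
    exact norm_stieltjes_integrand_le hM (le_of_lt ht) hw

lemma differentiableAt_stieltjes_right (hβ : 0 ≤ β)
    (hh : ∀ y : ℂ, β < y.re → DifferentiableAt ℂ h y) {U : Set ℂ} (hU : U ∈ 𝓝 z)
    (hUβ : ∀ z ∈ U, β < z.re)
    (hM : ∀ z ∈ U, ∀ w : ℝ, 0 < w → ‖h (z * (1 + w))‖ ≤ M / (1 + w) ^ 2)
    (hs : |s.re| < 1) : DifferentiableAt ℂ (stieltjes h s) z := by
  refine differentiableAt_integral_of_dominated (bound := fun w => M * weight |s.re| w)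
    hU (fun t ht => aestronglyMeasurable_stieltjes hβ hh (hUβ t ht)) ?_ ?_
    ((integrableOn_weight (abs_nonneg _) hs).const_mul M)
  · filter_upwards [ae_restrict_mem measurableSet_Ioi] with w hw t ht
    refine (DifferentiableAt.const_mul ?_ _).differentiableWithinAt
    exact DifferentiableAt.comp (f := fun t : ℂ => t * (1 + (w : ℂ))) t
      (hh _ (lt_re_mul_one_add hβ (hUβ t ht) hw)) (by fun_prop)
  · filter_upwards [ae_restrict_mem measurableSet_Ioi] with w hw t ht
    exact norm_stieltjes_integrand_le (hM t ht) le_rfl hw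

end stieltjes

end

/-! ### Interchanging the Laplace and Stieltjes integrals -/

lemma integral_cpow_neg_mul_exp {s : ℂ} (hs : s.re < 1) {r : ℝ} (hr : 0 < r) :
    ∫ w in Ioi (0 : ℝ), (w : ℂ) ^ (-s) * Complex.exp (-(r * w)) =
      Complex.Gamma (1 - s) * (r : ℂ) ^ (s - 1) := by
  have h := Complex.integral_cpow_mul_exp_neg_mul_Ioi (a := 1 - s) (r := r)
    (by simpa using hs) hr
  rw [show 1 - s - 1 = -s by ring] at h
  rw [h, one_div, Complex.inv_cpow _ _ (by
    rw [Complex.arg_ofReal_of_nonneg hr.le]; exact Real.pi_pos.ne), ← Complex.cpow_neg, neg_sub,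
    mul_comm]

lemma integral_rpow_neg_mul_exp {a : ℝ} (ha : a < 1) {r : ℝ} (hr : 0 < r) :
    ∫ w in Ioi (0 : ℝ), w ^ (-a) * Real.exp (-(r * w)) = Real.Gamma (1 - a) * r ^ (a - 1) := by
  have h := Real.integral_rpow_mul_exp_neg_mul_Ioi (a := 1 - a) (r := r) (by linarith) hr
  rw [show 1 - a - 1 = -a by ring] at h
  rw [h, one_div, Real.inv_rpow hr.le, ← Real.rpow_neg hr.le, neg_sub, mul_comm]

lemma integrableOn_rpow_neg_mul_exp {a : ℝ} (ha : a < 1) {r : ℝ} (hr : 0 < r) :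
    IntegrableOn (fun w : ℝ => w ^ (-a) * Real.exp (-(r * w))) (Ioi 0) := by
  simpa using integrableOn_rpow_mul_exp_neg_mul_rpow (s := -a) (p := 1) (b := r)
    (by linarith) one_pos hr

lemma stieltjes_laplace {f : ℝ → ℂ} (hf : Continuous f) {C β : ℝ} (hβ : 0 ≤ β)
    (hC : ∀ v, 0 ≤ v → ‖f v‖ ≤ C * v * Real.exp (β * v)) {x : ℝ} (hx : β < x) {s : ℂ}
    (hs : |s.re| < 1) :
    stieltjes (laplace f) s x = Complex.Gamma (1 - s) * (x : ℂ) ^ (s - 1) *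
      mellin (fun v : ℝ => f v * Complex.exp (-(x * v))) s := by
  have hx0 : 0 < x := hβ.trans_lt hx
  obtain ⟨hs1, hs2⟩ := abs_lt.1 hs
  set F : ℝ → ℝ → ℂ := fun w v =>
    (w : ℂ) ^ (-s) * (f v * Complex.exp (-(x * (1 + w)) * v)) with hF
  have hF' : ∀ w v, F w v = f v * Complex.exp (-(x * v)) *
      ((w : ℂ) ^ (-s) * Complex.exp (-((x * v : ℝ) * w))) := by
    intro w v
    have : -((x : ℂ) * (1 + w)) * v = -(x * v) + -((x * v : ℝ) * w) := by push_cast; ring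
    simp only [hF]
    rw [this, Complex.exp_add]
    ring
  have hnorm : ∀ w v : ℝ, 0 < w → ‖F w v‖ = ‖f v‖ * Real.exp (-(x * v)) *
      (w ^ (-s.re) * Real.exp (-(x * v * w))) := by
    intro w v hw
    rw [hF', norm_mul, norm_mul, norm_mul, Complex.norm_cpow_eq_rpow_re_of_pos hw,
      Complex.norm_exp, Complex.norm_exp]
    congr 3
    · simp
    · simp
  have hmeas : AEStronglyMeasurable (Function.uncurry F)
      ((volume.restrict (Ioi 0)).prod (volume.restrict (Ioi 0))) := by
    refine Measurable.aestronglyMeasurable ?_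
    have h1 : Measurable f := hf.measurable
    simp only [hF, Function.uncurry_def]
    fun_prop
  have hint : Integrable (Function.uncurry F)
      ((volume.restrict (Ioi 0)).prod (volume.restrict (Ioi 0))) := by
    rw [integrable_prod_iff' hmeas]
    constructor
    · filter_upwards [ae_restrict_mem measurableSet_Ioi] with v hv
      have hv0 : 0 < v := hv
      refine Integrable.mono' ((integrableOn_rpow_neg_mul_exp hs2 (mul_pos hx0 hv0)).const_mul
        (‖f v‖ * Real.exp (-(x * v)))) ?_ ?_
      · refine Measurable.aestronglyMeasurable ?_
        simp only [hF, Function.uncurry_apply_pair]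
        fun_prop
      · filter_upwards [ae_restrict_mem measurableSet_Ioi] with w hw
        exact (hnorm w v hw).le
    · have hdom : IntegrableOn (fun v : ℝ => C * Real.Gamma (1 - s.re) * x ^ (s.re - 1) *
          (v ^ (- -s.re) * Real.exp (-((x - β) * v)))) (Ioi 0) :=
        (integrableOn_rpow_neg_mul_exp (by linarith) (sub_pos.2 hx)).const_mul _
      have hmeas' : AEStronglyMeasurable (fun p => ‖Function.uncurry F p‖)
          ((volume.restrict (Ioi 0)).prod (volume.restrict (Ioi 0))) := hmeas.norm
      refine Integrable.mono' hdom hmeas'.prod_swap.integral_prod_right' ?_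
      filter_upwards [ae_restrict_mem measurableSet_Ioi] with v hv
      have hv0 : 0 < v := hv
      have hG : 0 < Real.Gamma (1 - s.re) := Real.Gamma_pos_of_pos (by linarith)
      rw [Real.norm_of_nonneg (integral_nonneg fun _ => norm_nonneg _)]
      calc ∫ w in Ioi (0 : ℝ), ‖Function.uncurry F (w, v)‖
          = ∫ w in Ioi (0 : ℝ), ‖f v‖ * Real.exp (-(x * v)) *
            (w ^ (-s.re) * Real.exp (-(x * v * w))) :=
            setIntegral_congr_fun measurableSet_Ioi fun w hw => hnorm w v hw
        _ = ‖f v‖ * Real.exp (-(x * v)) * (Real.Gamma (1 - s.re) * (x * v) ^ (s.re - 1)) := by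
            rw [integral_const_mul, integral_rpow_neg_mul_exp hs2 (mul_pos hx0 hv0)]
        _ ≤ C * v * Real.exp (β * v) * Real.exp (-(x * v)) *
            (Real.Gamma (1 - s.re) * (x * v) ^ (s.re - 1)) := by
            have := hC v hv0.le
            gcongr
        _ = _ := by
            rw [Real.mul_rpow hx0.le hv0.le, neg_neg, Real.rpow_sub_one hv0.ne',
              show -((x - β) * v) = β * v + -(x * v) by ring, Real.exp_add]
            field_simp
  calc stieltjes (laplace f) s x
      = ∫ w in Ioi (0 : ℝ), ∫ v in Ioi (0 : ℝ), F w v := by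
        refine setIntegral_congr_fun measurableSet_Ioi fun w hw => ?_
        simp only [laplace, hF]
        rw [integral_const_mul]
    _ = ∫ v in Ioi (0 : ℝ), ∫ w in Ioi (0 : ℝ), F w v := integral_integral_swap hint
    _ = ∫ v in Ioi (0 : ℝ), Complex.Gamma (1 - s) * (x : ℂ) ^ (s - 1) *
          ((v : ℂ) ^ (s - 1) • (f v * Complex.exp (-(x * v)))) := by
        refine setIntegral_congr_fun measurableSet_Ioi fun v hv => ?_
        have hv0 : 0 < v := hv
        simp only [hF']
        rw [integral_const_mul, integral_cpow_neg_mul_exp hs2 (mul_pos hx0 hv0),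
          Complex.ofReal_mul, Complex.mul_cpow_ofReal_nonneg hx0.le hv0.le, smul_eq_mul]
        ring
    _ = _ := by rw [integral_const_mul, mellin]

lemma sin_div_pi_mul_Gamma {s : ℂ} (hs : |s.re| < 1) :
    Complex.sin (Real.pi * s) / Real.pi * Complex.Gamma (1 - s) = (Complex.Gamma s)⁻¹ := by
  obtain ⟨h1, h2⟩ := abs_lt.1 hs
  rcases eq_or_ne s 0 with rfl | h0
  · simp
  have hG : Complex.Gamma s ≠ 0 := by
    refine Complex.Gamma_ne_zero fun m hm => ?_
    have hre := congrArg Complex.re hm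
    simp only [Complex.neg_re, Complex.natCast_re] at hre
    have hm0 : m = 0 := by
      have : (m : ℝ) < 1 := by linarith
      have : m < 1 := by exact_mod_cast this
      omega
    rw [hm0] at hm
    simp at hm
    exact h0 hm
  have hG' : Complex.Gamma (1 - s) ≠ 0 :=
    Complex.Gamma_ne_zero_of_re_pos (by simpa using h2)
  have h := Complex.Gamma_mul_Gamma_one_sub s
  have hpi : (Real.pi : ℂ) ≠ 0 := by exact_mod_cast Real.pi_ne_zero
  have hsin : Complex.sin (Real.pi * s) ≠ 0 := by
    intro h0
    rw [h0, div_zero] at h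
    exact mul_ne_zero hG hG' h
  field_simp
  rw [eq_div_iff hsin] at h
  linear_combination h

lemma inv_Gamma_mul_Gamma_add {s : ℂ} (hs : |s.re| < 1) {k : ℕ} (hk : 1 ≤ k) :
    (Complex.Gamma s)⁻¹ * Complex.Gamma (s + k) = (ascPochhammer ℂ k).eval s := by
  obtain ⟨h1, h2⟩ := abs_lt.1 hs
  rcases eq_or_ne s 0 with rfl | h0
  · rw [ascPochhammer_eval_zero, if_neg (by omega)]
    simp
  have hs' : ∀ m : ℕ, s ≠ -m := by
    intro m hm
    have hre := congrArg Complex.re hm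
    simp only [Complex.neg_re, Complex.natCast_re] at hre
    have hm0 : m = 0 := by
      have : (m : ℝ) < 1 := by linarith
      have : m < 1 := by exact_mod_cast this
      omega
    rw [hm0] at hm
    simp at hm
    exact h0 hm
  rw [← Complex.Gamma_add_nat_div_Gamma_eq s hs', mul_comm, div_eq_mul_inv]

lemma sin_div_pi_mul_integral {s : ℂ} (hs : |s.re| < 1) {k : ℕ} (hk : 1 ≤ k) :
    Complex.sin (Real.pi * s) / Real.pi *
      (∫ w in Ioi (0 : ℝ), (w : ℂ) ^ (-s) * ((1 + w : ℂ) ^ (k + 1))⁻¹) =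
        (ascPochhammer ℂ k).eval s / (k ! : ℂ) := by
  obtain ⟨h1, h2⟩ := abs_lt.1 hs
  have hk! : (k ! : ℂ) ≠ 0 := by exact_mod_cast k.factorial_ne_zero
  have hb : ∀ v : ℝ, 0 ≤ v → ‖((v : ℂ)) ^ k‖ ≤
      (2 ^ (k - 1) * ((k - 1)! : ℝ)) * v * Real.exp (1 / 2 * v) := by
    intro v hv
    obtain ⟨j, rfl⟩ : ∃ j, k = j + 1 := ⟨k - 1, by omega⟩
    have h3 := Real.pow_div_factorial_le_exp (1 / 2 * v) (by positivity) j
    rw [div_le_iff₀ (by positivity), mul_pow] at h3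
    rw [norm_pow, Complex.norm_real, Real.norm_of_nonneg hv, Nat.add_sub_cancel, pow_succ]
    have h4 : v ^ j ≤ 2 ^ j * (Real.exp (1 / 2 * v) * (j ! : ℝ)) := by
      calc v ^ j = 2 ^ j * ((1 / 2) ^ j * v ^ j) := by
            rw [← mul_assoc, ← mul_pow]
            norm_num
        _ ≤ _ := by gcongr
    calc v ^ j * v ≤ 2 ^ j * (Real.exp (1 / 2 * v) * (j ! : ℝ)) * v := by gcongr
      _ = _ := by ring
  have hL := stieltjes_laplace (f := fun v => (v : ℂ) ^ k) (by fun_prop) (β := 1 / 2)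
    (by norm_num) hb (x := 1) (by norm_num) hs
  have hleft : stieltjes (laplace fun v => (v : ℂ) ^ k) s (1 : ℝ) = (k ! : ℂ) *
      ∫ w in Ioi (0 : ℝ), (w : ℂ) ^ (-s) * ((1 + w : ℂ) ^ (k + 1))⁻¹ := by
    rw [stieltjes, ← integral_const_mul]
    refine setIntegral_congr_fun measurableSet_Ioi fun w hw => ?_
    have hw0 : 0 < w := hw
    have h := Complex.integral_cpow_mul_exp_neg_mul_Ioi (a := k + 1) (r := 1 + w)
      (by simp; positivity) (by positivity)
    have h5 : laplace (fun v => (v : ℂ) ^ k) ((1 : ℝ) * (1 + w)) =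
        ((1 + w : ℂ) ^ (k + 1))⁻¹ * (k ! : ℂ) := by
      rw [add_sub_cancel_right, Complex.Gamma_nat_eq_factorial] at h
      rw [laplace, one_div] at *
      rw [show ((k : ℂ) + 1) = ((k + 1 : ℕ) : ℂ) by push_cast; rfl, Complex.cpow_natCast] at h
      rw [← inv_pow]
      push_cast at h ⊢
      rw [← h]
      refine setIntegral_congr_fun measurableSet_Ioi fun v _ => ?_
      simp only [Complex.cpow_natCast, one_mul, neg_mul]
    simp only [h5]
    ring
  have hright : mellin (fun v : ℝ => (v : ℂ) ^ k * Complex.exp (-((1 : ℝ) * v))) s =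
      Complex.Gamma (s + k) := by
    rw [Complex.Gamma_eq_integral (by
      simp only [Complex.add_re, Complex.natCast_re]
      have : (1 : ℝ) ≤ k := by exact_mod_cast hk
      linarith), Complex.GammaIntegral, mellin]
    refine setIntegral_congr_fun measurableSet_Ioi fun v hv => ?_
    have hv0 : (v : ℂ) ≠ 0 := by exact_mod_cast (ne_of_gt hv)
    simp only [smul_eq_mul, Complex.ofReal_one, one_mul]
    rw [show s + k - 1 = (s - 1) + k by ring, Complex.cpow_add _ _ hv0, Complex.cpow_natCast]
    push_cast
    ring
  rw [hleft, hright] at hL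
  rw [← inv_Gamma_mul_Gamma_add hs hk, ← sin_div_pi_mul_Gamma hs]
  simp only [Complex.ofReal_one, Complex.one_cpow, mul_one] at hL
  field_simp
  simp only [← div_eq_mul_inv] at hL
  linear_combination Complex.sin (Real.pi * s) * hL

section

/-! ### The remainder function and its expansion -/

/-- The function `F(s, z)` with `z ^ s ζ(s, z + b) = z / (s - 1) + F(s, z)`. -/
noncomputable def hurwitzRem (b : ℝ) (s z : ℂ) : ℂ :=
  kernelFun b 0 + z * (Complex.sin (Real.pi * s) / Real.pi * stieltjes (laplaceRem b 1) s z)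

variable {b : ℝ}

lemma exists_norm_laplaceRem_mul_le {σ ρ : ℝ} (hσ : kernelType b < σ) (hρ0 : 0 < ρ)
    (hρ : ρ < 2 * Real.pi) : ∃ C : ℝ, 0 < C ∧ ∀ K : ℕ, 1 ≤ K → ∀ z : ℂ, σ ≤ z.re →
      ∀ w : ℝ, 0 < w → ‖laplaceRem b K (z * (1 + w))‖ ≤
        C * (K ! : ℝ) / ρ ^ K / ‖z‖ ^ (K + 1) / (1 + w) ^ 2 := by
  obtain ⟨C, hC, h⟩ := exists_norm_laplaceRem_le hσ hρ0 hρ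
  refine ⟨C, hC, fun K hK z hz w hw => ?_⟩
  have hσ0 : 0 < σ := (kernelType_nonneg b).trans_lt hσ
  have hre : (z * (1 + (w : ℂ))).re = z.re * (1 + w) := by simp
  have hz0 : 0 < ‖z‖ := hσ0.trans_le (hz.trans (Complex.re_le_norm z))
  refine (h K _ (by rw [hre]; nlinarith)).trans ?_
  rw [norm_mul_one_add hw, mul_pow, ← div_div]
  gcongr
  · linarith
  · omega

lemma differentiableAt_stieltjes_laplaceRem_left {K : ℕ} (hK : 1 ≤ K) {s z : ℂ}
    (hz : kernelType b < z.re) (hs : |s.re| < 1) :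
    DifferentiableAt ℂ (fun s => stieltjes (laplaceRem b K) s z) s := by
  obtain ⟨C, -, h⟩ := exists_norm_laplaceRem_mul_le hz one_pos (by linarith [Real.pi_gt_three])
  exact differentiableAt_stieltjes_left (kernelType_nonneg b)
    (fun y => differentiableAt_laplaceRem K) hz (h K hK z le_rfl) hs

lemma differentiableAt_hurwitzRem_left {s z : ℂ} (hz : kernelType b < z.re) (hs : |s.re| < 1) :
    DifferentiableAt ℂ (fun s => hurwitzRem b s z) s := by
  have := differentiableAt_stieltjes_laplaceRem_left le_rfl hz hs
  unfold hurwitzRem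
  fun_prop

lemma abs_re_lt_one_of_mem_ball {s : ℂ} {r : ℝ} (hs : s ∈ Metric.closedBall (0 : ℂ) r) :
    |s.re| ≤ r :=
  (Complex.abs_re_le_norm s).trans (mem_closedBall_zero_iff.1 hs)

lemma diffContOnCl_hurwitzRem {z : ℂ} (hz : kernelType b < z.re) :
    DiffContOnCl ℂ (fun s => hurwitzRem b s z) (Metric.ball 0 (1 / 2)) := by
  refine DifferentiableOn.diffContOnCl fun s hs => ?_
  have h := abs_re_lt_one_of_mem_ball (Metric.closure_ball_subset_closedBall hs)
  exact (differentiableAt_hurwitzRem_left hz (by linarith)).differentiableWithinAt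

lemma analyticAt_hurwitzRem_left {z : ℂ} (hz : kernelType b < z.re) :
    AnalyticAt ℂ (fun s => hurwitzRem b s z) 0 :=
  (diffContOnCl_hurwitzRem hz).differentiableOn.analyticAt
    (Metric.ball_mem_nhds 0 (by norm_num))

lemma exists_norm_sin_div_pi_le (r : ℝ) : ∃ S : ℝ, 0 < S ∧ ∀ s ∈ Metric.closedBall (0 : ℂ) r,
    ‖Complex.sin (Real.pi * s) / Real.pi‖ ≤ S := by
  obtain ⟨S, hS⟩ := (isCompact_closedBall (0 : ℂ) r).exists_bound_of_continuousOn
    (f := fun s => Complex.sin (Real.pi * s) / Real.pi) (by fun_prop)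
  exact ⟨max S 1, by positivity, fun s hs => (hS s hs).trans (le_max_left _ _)⟩

lemma norm_stieltjes_laplaceRem_le {σ ρ : ℝ} (hσ : kernelType b < σ) (hρ0 : 0 < ρ)
    (hρ : ρ < 2 * Real.pi) : ∃ C : ℝ, 0 < C ∧ ∀ K : ℕ, 1 ≤ K → ∀ z : ℂ, σ ≤ z.re →
      ∀ s ∈ Metric.closedBall (0 : ℂ) (1 / 2),
        ‖z * (Complex.sin (Real.pi * s) / Real.pi * stieltjes (laplaceRem b K) s z)‖ ≤
          C * (K ! : ℝ) / (ρ * ‖z‖) ^ K := by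
  obtain ⟨C, hC, h⟩ := exists_norm_laplaceRem_mul_le hσ hρ0 hρ
  obtain ⟨S, hS, hS'⟩ := exists_norm_sin_div_pi_le (1 / 2)
  set I := ∫ w in Ioi (0 : ℝ), weight (1 / 2) w with hI
  have hI0 : 0 ≤ I := integral_weight_nonneg _
  refine ⟨S * C * (I + 1), by positivity, fun K hK z hz s hs => ?_⟩
  have hσ0 : 0 < σ := (kernelType_nonneg b).trans_lt hσ
  have hz0 : 0 < ‖z‖ := hσ0.trans_le (hz.trans (Complex.re_le_norm z))
  have h1 := norm_stieltjes_le (h K hK z hz) (by norm_num) (abs_re_lt_one_of_mem_ball hs)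
  rw [← hI] at h1
  rw [norm_mul, norm_mul]
  calc ‖z‖ * (‖Complex.sin (Real.pi * s) / Real.pi‖ * ‖stieltjes (laplaceRem b K) s z‖)
      ≤ ‖z‖ * (S * (C * (K ! : ℝ) / ρ ^ K / ‖z‖ ^ (K + 1) * (I + 1))) := by
        gcongr
        · exact hS' s hs
        · exact h1.trans (by gcongr; linarith)
    _ = _ := by
        rw [mul_pow, pow_succ]
        field_simp

lemma differentiableAt_hurwitzRem_right {s z : ℂ} (hz : kernelType b < z.re) (hs : |s.re| < 1) :
    DifferentiableAt ℂ (hurwitzRem b s) z := by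
  obtain ⟨σ, hσ, hσz⟩ := exists_between hz
  have hσ0 : 0 < σ := (kernelType_nonneg b).trans_lt hσ
  obtain ⟨C, hC, h⟩ := exists_norm_laplaceRem_mul_le hσ one_pos (by linarith [Real.pi_gt_three])
  have hopen : IsOpen {z : ℂ | σ < z.re} := isOpen_lt continuous_const (by fun_prop)
  have hS : DifferentiableAt ℂ (stieltjes (laplaceRem b 1) s) z := by
    refine differentiableAt_stieltjes_right (M := C / σ ^ 2) (kernelType_nonneg b)
      (fun y => differentiableAt_laplaceRem 1) (hopen.mem_nhds hσz)
      (fun z hz => hσ.trans hz) (fun z hz w hw => ?_) hs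
    have hz' : σ < z.re := hz
    have hn : σ ≤ ‖z‖ := hz'.le.trans (Complex.re_le_norm z)
    refine (h 1 le_rfl z hz'.le w hw).trans ?_
    simp only [Nat.factorial_one, Nat.cast_one, mul_one, one_pow, div_one]
    gcongr
  unfold hurwitzRem
  fun_prop

lemma stieltjes_laplaceRem_succ {K : ℕ} (hK : 1 ≤ K) {s z : ℂ} (hz : kernelType b < z.re)
    (hs : |s.re| < 1) :
    z * (Complex.sin (Real.pi * s) / Real.pi * stieltjes (laplaceRem b K) s z) =
      (ascPochhammer ℂ K).eval s * maclaurinCoeff (kernelFun b) K / z ^ K +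
      z * (Complex.sin (Real.pi * s) / Real.pi * stieltjes (laplaceRem b (K + 1)) s z) := by
  obtain ⟨C, -, h⟩ := exists_norm_laplaceRem_mul_le hz one_pos (by linarith [Real.pi_gt_three])
  have hz0 := ne_zero_of_kernelType_lt hz
  have hint : ∀ K, 1 ≤ K → IntegrableOn (fun w : ℝ =>
      (w : ℂ) ^ (-s) * laplaceRem b K (z * (1 + w))) (Ioi 0) := fun K hK =>
    integrableOn_stieltjes (kernelType_nonneg b) (fun y => differentiableAt_laplaceRem K) hz
      (h K hK z le_rfl) hs
  have hdiff : ∀ w ∈ Ioi (0 : ℝ), (w : ℂ) ^ (-s) * laplaceRem b K (z * (1 + w)) -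
      (w : ℂ) ^ (-s) * laplaceRem b (K + 1) (z * (1 + w)) =
      iteratedDeriv K (kernelFun b) 0 / z ^ (K + 1) *
        ((w : ℂ) ^ (-s) * ((1 + w : ℂ) ^ (K + 1))⁻¹) := fun w hw => by
    rw [laplaceRem_succ K (lt_re_mul_one_add (kernelType_nonneg b) hz hw), mul_pow,
      div_mul_eq_div_div, div_eq_mul_inv _ ((1 + w : ℂ) ^ (K + 1))]
    ring
  have key : stieltjes (laplaceRem b K) s z - stieltjes (laplaceRem b (K + 1)) s z =
      iteratedDeriv K (kernelFun b) 0 / z ^ (K + 1) *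
        ∫ w in Ioi (0 : ℝ), (w : ℂ) ^ (-s) * ((1 + w : ℂ) ^ (K + 1))⁻¹ := by
    rw [stieltjes, stieltjes, ← integral_sub (hint K hK) (hint (K + 1) (by omega)),
      ← integral_const_mul]
    exact setIntegral_congr_fun measurableSet_Ioi hdiff
  have hsin := sin_div_pi_mul_integral hs hK
  rw [sub_eq_iff_eq_add.1 key, maclaurinCoeff, mul_add, mul_left_comm, hsin]
  field_simp
  ring

lemma hurwitzRem_sub_sum {K : ℕ} (hK : 1 ≤ K) {s z : ℂ} (hz : kernelType b < z.re)
    (hs : |s.re| < 1) :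
    hurwitzRem b s z - ∑ k ∈ Finset.range K,
        (ascPochhammer ℂ k).eval s * (maclaurinCoeff (kernelFun b) k / z ^ k) =
      z * (Complex.sin (Real.pi * s) / Real.pi * stieltjes (laplaceRem b K) s z) := by
  induction K, hK using Nat.le_induction with
  | base => simp [hurwitzRem, maclaurinCoeff]
  | succ K hK ih =>
    rw [Finset.sum_range_succ, ← sub_sub, ih, stieltjes_laplaceRem_succ hK hz hs]
    ring

lemma maclaurinCoeff_kernelFun_eq (n k : ℕ) (a : ℝ) :
    (Nat.stirlingFirst k n : ℂ) * maclaurinCoeff (kernelFun (a - 1)) k = (term a n k : ℂ) := by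
  rw [maclaurinCoeff_kernelFun, term]
  push_cast
  ring

lemma norm_maclaurinCoeff_hurwitzRem_sub_le (hb : -1 < b) {ρ : ℝ} (hρ0 : 0 < ρ)
    (hρ : ρ < 2 * Real.pi) (n : ℕ) : ∃ C : ℝ, 0 < C ∧ ∀ K : ℕ, 1 ≤ K → ∀ z : ℂ, 1 ≤ z.re →
      ‖maclaurinCoeff (fun s => hurwitzRem b s z) n - ∑ k ∈ Finset.range K,
        (Nat.stirlingFirst k n : ℂ) * maclaurinCoeff (kernelFun b) k / z ^ k‖ ≤
          C * (K ! : ℝ) / (ρ * ‖z‖) ^ K := by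
  obtain ⟨C, hC, h⟩ := norm_stieltjes_laplaceRem_le (kernelType_lt_one hb) hρ0 hρ
  refine ⟨C * 2 ^ n, by positivity, fun K hK z hz => ?_⟩
  have hz' : kernelType b < z.re := (kernelType_lt_one hb).trans_le hz
  have hp : ∀ k ∈ Finset.range K, AnalyticAt ℂ (fun s => (ascPochhammer ℂ k).eval s *
      (maclaurinCoeff (kernelFun b) k / z ^ k)) 0 := fun k _ =>
    ((Polynomial.differentiable _).analyticAt 0).mul analyticAt_const
  have heq : maclaurinCoeff (fun s => hurwitzRem b s z) n - ∑ k ∈ Finset.range K,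
        (Nat.stirlingFirst k n : ℂ) * maclaurinCoeff (kernelFun b) k / z ^ k =
      maclaurinCoeff (fun s => hurwitzRem b s z - ∑ k ∈ Finset.range K,
        (ascPochhammer ℂ k).eval s * (maclaurinCoeff (kernelFun b) k / z ^ k)) n := by
    rw [maclaurinCoeff_sub (analyticAt_hurwitzRem_left hz')
      (Finset.analyticAt_fun_sum _ hp), maclaurinCoeff_sum _ hp]
    congr 1
    refine Finset.sum_congr rfl fun k _ => ?_
    rw [maclaurinCoeff_mul_const, maclaurinCoeff_ascPochhammer]
    ring
  rw [heq]
  refine (norm_maclaurinCoeff_le (r := 1 / 2) (C := C * (K ! : ℝ) / (ρ * ‖z‖) ^ K)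
    (by norm_num) ?_ (fun s hs => ?_) n).trans (le_of_eq ?_)
  · refine (diffContOnCl_hurwitzRem hz').sub (Differentiable.diffContOnCl ?_)
    fun_prop
  · have hs' := Metric.sphere_subset_closedBall hs
    have hre := abs_re_lt_one_of_mem_ball hs'
    rw [hurwitzRem_sub_sum hK hz' (by linarith)]
    exact h K hK z hz s hs'
  · rw [one_div, inv_pow, div_inv_eq_mul]
    ring

lemma differentiableAt_maclaurinCoeff_hurwitzRem {z : ℂ} (hz : kernelType b < z.re) (n : ℕ) :
    DifferentiableAt ℂ (fun z => maclaurinCoeff (fun s => hurwitzRem b s z) n) z := by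
  obtain ⟨σ, hσ, hσz⟩ := exists_between hz
  have hσ0 : 0 < σ := (kernelType_nonneg b).trans_lt hσ
  obtain ⟨C, hC, h⟩ := norm_stieltjes_laplaceRem_le hσ one_pos (by linarith [Real.pi_gt_three])
  have hopen : IsOpen {z : ℂ | σ < z.re} := isOpen_lt continuous_const (by fun_prop)
  refine differentiableAt_maclaurinCoeff (f := fun z s => hurwitzRem b s z) (r := 1 / 2)
    (C := ‖kernelFun b 0‖ + C / σ) (by norm_num) (hopen.mem_nhds hσz)
    (fun z hz => diffContOnCl_hurwitzRem (hσ.trans hz)) (fun s hs z hz => ?_)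
    (fun z hz s hs => ?_) n
  · have hre := abs_re_lt_one_of_mem_ball (Metric.sphere_subset_closedBall hs)
    exact (differentiableAt_hurwitzRem_right (hσ.trans hz) (by linarith)).differentiableWithinAt
  · have hz' : σ < z.re := hz
    have hn : σ ≤ ‖z‖ := hz'.le.trans (Complex.re_le_norm z)
    have h1 := h 1 le_rfl z hz'.le s (Metric.sphere_subset_closedBall hs)
    rw [Nat.factorial_one, Nat.cast_one, mul_one, one_mul, pow_one] at h1
    refine (norm_add_le _ _).trans (add_le_add le_rfl (h1.trans ?_))
    gcongr

theorem isSemiconvergentExpansion_hurwitzRem {a : ℝ} (ha : 0 < a) (n : ℕ) :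
    IsSemiconvergentExpansion (fun k => (term a n k : ℂ)) (2 * Real.pi)
      (fun z => maclaurinCoeff (fun s => hurwitzRem (a - 1) s z) n) where
  analytic := by
    have hβ := kernelType_lt_one (b := a - 1) (by linarith)
    have hopen : IsOpen {z : ℂ | kernelType (a - 1) < z.re} :=
      isOpen_lt continuous_const (by fun_prop)
    intro z hz
    refine DifferentiableOn.analyticAt (s := {z : ℂ | kernelType (a - 1) < z.re})
      (fun w hw => ?_) (hopen.mem_nhds (hβ.trans_le hz))
    exact (differentiableAt_maclaurinCoeff_hurwitzRem hw n).differentiableWithinAt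
  error_le := by
    intro ρ hρ0 hρ
    obtain ⟨C, hC, h⟩ := norm_maclaurinCoeff_hurwitzRem_sub_le (b := a - 1) (by linarith) hρ0 hρ n
    simp only [maclaurinCoeff_kernelFun_eq] at h
    refine ⟨C + C / ρ + |term a n 0|, fun K z hz => ?_⟩
    have hn : 1 ≤ ‖z‖ := hz.trans (Complex.re_le_norm z)
    have hn0 : 0 < ‖z‖ := by linarith
    rcases Nat.eq_zero_or_pos K with rfl | hK
    · have h1 := h 1 le_rfl z hz
      simp only [Finset.sum_range_one, pow_zero, div_one, Nat.factorial_one, Nat.cast_one, mul_one,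
        pow_one] at h1
      simp only [Finset.range_zero, Finset.sum_empty, sub_zero, Nat.factorial_zero, Nat.cast_one,
        mul_one, pow_zero, div_one]
      have h2 : C / (ρ * ‖z‖) ≤ C / ρ := by
        gcongr
        nlinarith
      have h3 := norm_le_norm_sub_add (maclaurinCoeff (fun s => hurwitzRem (a - 1) s z) n)
        (term a n 0 : ℂ)
      rw [Complex.norm_real, Real.norm_eq_abs] at h3
      linarith
    · refine (h K hK z hz).trans ?_
      have : 0 ≤ C / ρ + |term a n 0| := by positivity
      gcongr
      linarith

end

section

/-! ### The Hurwitz zeta function as a Mellin transform -/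

lemma Gamma_mul_hurwitz {A : ℝ} (hA : 0 < A) {s : ℂ} (hs : 1 < s.re) :
    Complex.Gamma s * hurwitz A s =
      mellin (fun t : ℝ => Complex.exp (-A * t) / (1 - Complex.exp (-t))) s := by
  have hsum := hasSum_hurwitz hA hs
  have h := hasSum_mellin (ι := ℕ) (a := fun _ => 1) (p := fun i => (i : ℝ) + A)
    (F := fun t : ℝ => Complex.exp (-A * t) / (1 - Complex.exp (-t))) (s := s)
    (fun i => Or.inr (by positivity)) (by linarith) (fun t ht => ?_) ?_
  · refine (hsum.mul_left (Complex.Gamma s)).unique ?_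
    convert! h using 1
    funext i
    push_cast
    ring
  · have ht0 : 0 < t := ht
    have hq : ‖Complex.exp (-(t : ℂ))‖ < 1 := by
      rw [Complex.norm_exp]
      simpa using ht0
    convert! (hasSum_geometric_of_norm_lt_one hq).mul_left (Complex.exp (-A * t)) using 1
    funext i
    rw [one_mul, ← Complex.exp_nat_mul, ← Complex.exp_add, Complex.ofReal_exp]
    congr 1
    push_cast
    ring
  · convert hsum.summable.norm using 2 with i
    have hi : 0 < (i : ℝ) + A := by positivity
    rw [norm_div, show ((i : ℂ) + A) = ((i + A : ℝ) : ℂ) by push_cast; rfl,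
      Complex.norm_cpow_eq_rpow_re_of_pos hi]

lemma integrableOn_cpow_mul_exp {s : ℂ} (hs : 0 < s.re) {x : ℝ} (hx : 0 < x) :
    IntegrableOn (fun v : ℝ => (v : ℂ) ^ (s - 1) * Complex.exp (-(x * v))) (Ioi 0) := by
  refine Integrable.mono' (integrableOn_rpow_neg_mul_exp (a := 1 - s.re) (by linarith) hx)
    (Measurable.aestronglyMeasurable (by fun_prop)) ?_
  filter_upwards [ae_restrict_mem measurableSet_Ioi] with v hv
  rw [norm_mul, Complex.norm_cpow_eq_rpow_re_of_pos hv, Complex.norm_exp]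
  refine le_of_eq ?_
  congr 2
  · simp
  · simp

/-- The function whose Mellin transform continues the Hurwitz zeta function to `-1 < Re s`. -/
noncomputable def mellinKernel (b x v : ℝ) : ℂ :=
  (kernelFun b v - kernelFun b 0) * Complex.exp (-(x * v))

variable {b x : ℝ}

lemma continuous_kernelFun_sub (b : ℝ) : Continuous fun v : ℝ => kernelFun b v - kernelFun b 0 := by
  have := continuous_iteratedDeriv_kernelFun b 0
  simp only [iteratedDeriv_zero] at this
  exact this.sub continuous_const

lemma exists_norm_kernelFun_sub_le_exp (b : ℝ) : ∃ C : ℝ, 0 < C ∧ ∀ v : ℝ, 0 ≤ v →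
    ‖kernelFun b v - kernelFun b 0‖ ≤ C * Real.exp (kernelType b * v) := by
  obtain ⟨C, hC, h⟩ := exists_norm_iteratedDeriv_kernelFun_le b one_pos
    (by linarith [Real.pi_gt_three])
  refine ⟨C + ‖kernelFun b 0‖, by positivity, fun v hv => ?_⟩
  have h1 := h 0 v hv
  simp only [iteratedDeriv_zero, Nat.factorial_zero, Nat.cast_one, mul_one, pow_zero,
    div_one] at h1
  have h2 : 1 ≤ Real.exp (kernelType b * v) :=
    Real.one_le_exp (mul_nonneg (kernelType_nonneg b) hv)
  calc _ ≤ ‖kernelFun b v‖ + ‖kernelFun b 0‖ := norm_sub_le _ _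
    _ ≤ C * Real.exp (kernelType b * v) + ‖kernelFun b 0‖ * Real.exp (kernelType b * v) :=
        add_le_add h1 (le_mul_of_one_le_right (norm_nonneg _) h2)
    _ = _ := by ring

lemma norm_exp_neg_mul (x v : ℝ) : ‖Complex.exp (-((x : ℂ) * v))‖ = Real.exp (-(x * v)) := by
  rw [Complex.norm_exp]
  congr 1
  simp

lemma locallyIntegrableOn_mellinKernel (b x : ℝ) :
    LocallyIntegrableOn (mellinKernel b x) (Ioi 0) := by
  refine Continuous.locallyIntegrable ?_ |>.locallyIntegrableOn _
  exact (continuous_kernelFun_sub b).mul (by fun_prop)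

lemma isBigO_atTop_mellinKernel (b x : ℝ) :
    mellinKernel b x =O[atTop] fun v => Real.exp (-(x - kernelType b) * v) := by
  obtain ⟨C, hC, h⟩ := exists_norm_kernelFun_sub_le_exp b
  refine IsBigO.of_bound C ?_
  filter_upwards [eventually_ge_atTop 0] with v hv
  rw [mellinKernel, norm_mul, norm_exp_neg_mul, Real.norm_of_nonneg (Real.exp_pos _).le,
    show -(x - kernelType b) * v = kernelType b * v + -(x * v) by ring, Real.exp_add, ← mul_assoc]
  gcongr
  exact h v hv

lemma isBigO_zero_mellinKernel (b : ℝ) (hx : 0 ≤ x) :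
    mellinKernel b x =O[𝓝[>] 0] fun v => v ^ (-(-1) : ℝ) := by
  obtain ⟨C, hC, h⟩ := exists_norm_kernelFun_sub_le b
  refine IsBigO.of_bound (C * Real.exp (kernelType b)) ?_
  filter_upwards [Ioo_mem_nhdsGT one_pos] with v hv
  have hv0 : 0 < v := hv.1
  have hv1 : v ≤ 1 := hv.2.le
  rw [mellinKernel, norm_mul, norm_exp_neg_mul, neg_neg, Real.rpow_one,
    Real.norm_of_nonneg hv0.le]
  have h1 : Real.exp (-(x * v)) ≤ 1 := by
    rw [Real.exp_le_one_iff]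
    have := mul_nonneg hx hv0.le
    linarith
  have h2 : Real.exp (kernelType b * v) ≤ Real.exp (kernelType b) :=
    Real.exp_le_exp.2 (mul_le_of_le_one_right (kernelType_nonneg b) hv1)
  calc _ ≤ C * v * Real.exp (kernelType b * v) * 1 := by
        gcongr
        exact h v hv0.le
    _ ≤ C * v * Real.exp (kernelType b) * 1 := by gcongr
    _ = _ := by ring

lemma mellinConvergent_mellinKernel (hx : kernelType b < x) {s : ℂ} (hs : -1 < s.re) :
    MellinConvergent (mellinKernel b x) s :=
  mellinConvergent_of_isBigO_rpow_exp (sub_pos.2 hx) (locallyIntegrableOn_mellinKernel b x)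
    (isBigO_atTop_mellinKernel b x)
    (isBigO_zero_mellinKernel b ((kernelType_nonneg b).trans hx.le)) hs

lemma differentiableAt_mellin_mellinKernel (hx : kernelType b < x) {s : ℂ} (hs : -1 < s.re) :
    DifferentiableAt ℂ (mellin (mellinKernel b x)) s :=
  mellin_differentiableAt_of_isBigO_rpow_exp (sub_pos.2 hx) (locallyIntegrableOn_mellinKernel b x)
    (isBigO_atTop_mellinKernel b x)
    (isBigO_zero_mellinKernel b ((kernelType_nonneg b).trans hx.le)) hs

/-- The continuation of `x ^ s ζ(s, x + b)` to `-1 < Re s`. -/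
noncomputable def hurwitzContinuation (b x : ℝ) (s : ℂ) : ℂ :=
  x / (s - 1) + (kernelFun b 0 + (x : ℂ) ^ s * ((Complex.Gamma s)⁻¹ * mellin (mellinKernel b x) s))

lemma cpow_mul_hurwitz_of_one_lt_re (hb : 0 < x + b) (hx : kernelType b < x) {s : ℂ}
    (hs : 1 < s.re) : (x : ℂ) ^ s * hurwitz (x + b) s = hurwitzContinuation b x s := by
  have hx0 : 0 < x := (kernelType_nonneg b).trans_lt hx
  have hxc : (x : ℂ) ≠ 0 := by exact_mod_cast hx0.ne'
  have hG : Complex.Gamma s ≠ 0 := Complex.Gamma_ne_zero_of_re_pos (by linarith)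
  have hs1 : s - 1 ≠ 0 := by
    intro h
    have := congrArg Complex.re h
    simp at this
    linarith
  have hint1 := integrableOn_cpow_mul_exp (s := s) (by linarith) hx0
  have hint2 := integrableOn_cpow_mul_exp (s := s - 1) (by simpa using hs) hx0
  have hint0 : IntegrableOn (fun v : ℝ => (v : ℂ) ^ (s - 1) • mellinKernel b x v) (Ioi 0) :=
    mellinConvergent_mellinKernel hx (by linarith)
  have hI1 := Complex.integral_cpow_mul_exp_neg_mul_Ioi (a := s) (r := x) (by linarith) hx0
  have hI2 := Complex.integral_cpow_mul_exp_neg_mul_Ioi (a := s - 1) (r := x)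
    (by simpa using hs) hx0
  have hpow : ∀ t : ℂ, (1 / (x : ℂ)) ^ t = (x : ℂ) ^ (-t) := fun t => by
    rw [one_div, Complex.inv_cpow _ _ (by
      rw [Complex.arg_ofReal_of_nonneg hx0.le]; exact Real.pi_pos.ne), ← Complex.cpow_neg]
  have key : Complex.Gamma s * hurwitz (x + b) s = mellin (mellinKernel b x) s +
      kernelFun b 0 * ((x : ℂ) ^ (-s) * Complex.Gamma s) +
        (x : ℂ) ^ (-(s - 1)) * Complex.Gamma (s - 1) := by
    rw [Gamma_mul_hurwitz hb hs, ← hpow, ← hpow, ← hI1, ← hI2, mellin, mellin,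
      ← integral_const_mul, ← integral_add hint0 (hint1.const_mul _),
      ← integral_add (f := fun v : ℝ => (v : ℂ) ^ (s - 1) • mellinKernel b x v +
        kernelFun b 0 * ((v : ℂ) ^ (s - 1) * Complex.exp (-(x * v))))
        (hint0.add (hint1.const_mul _)) hint2]
    refine setIntegral_congr_fun measurableSet_Ioi fun v hv => ?_
    have hv0 : (v : ℂ) ≠ 0 := by exact_mod_cast (ne_of_gt hv)
    simp only [smul_eq_mul, mellinKernel]
    rw [kernelFun_of_ne b hv0, Complex.cpow_sub (s - 1) 1 hv0, Complex.cpow_one]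
    have : Complex.exp (-((x + b : ℝ) : ℂ) * v) =
        Complex.exp (-b * v) * Complex.exp (-(x * v)) := by
      rw [← Complex.exp_add]
      congr 1
      push_cast
      ring
    rw [this]
    ring
  have hGs : Complex.Gamma s = (s - 1) * Complex.Gamma (s - 1) := by
    have := Complex.Gamma_add_one (s - 1) hs1
    rwa [sub_add_cancel] at this
  have hG1 : Complex.Gamma (s - 1) ≠ 0 := by
    intro h
    rw [hGs, h, mul_zero] at hG
    exact hG rfl
  have hp1 : (x : ℂ) ^ s * (x : ℂ) ^ (-s) = 1 := by
    rw [← Complex.cpow_add _ _ hxc, add_neg_cancel, Complex.cpow_zero]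
  have hp2 : (x : ℂ) ^ s * (x : ℂ) ^ (-(s - 1)) = x := by
    rw [← Complex.cpow_add _ _ hxc]
    simp
  refine mul_left_cancel₀ hG ?_
  rw [hurwitzContinuation]
  calc Complex.Gamma s * ((x : ℂ) ^ s * hurwitz (x + b) s)
      = (x : ℂ) ^ s * (Complex.Gamma s * hurwitz (x + b) s) := by ring
    _ = (x : ℂ) ^ s * mellin (mellinKernel b x) s +
          ((x : ℂ) ^ s * (x : ℂ) ^ (-s)) * kernelFun b 0 * Complex.Gamma s +
          ((x : ℂ) ^ s * (x : ℂ) ^ (-(s - 1))) * Complex.Gamma (s - 1) := by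
        rw [key]
        ring
    _ = _ := by
        rw [hp1, hp2, hGs]
        field_simp
        ring

lemma differentiableAt_hurwitzContinuation (hx : kernelType b < x) {s : ℂ} (hs : -1 < s.re)
    (hs1 : s ≠ 1) : DifferentiableAt ℂ (hurwitzContinuation b x) s := by
  have hx0 : (x : ℂ) ≠ 0 := by exact_mod_cast ((kernelType_nonneg b).trans_lt hx).ne'
  have h1 : DifferentiableAt ℂ (fun s : ℂ => (x : ℂ) / (s - 1)) s :=
    (differentiableAt_const _).div (by fun_prop) (sub_ne_zero.2 hs1)
  have h2 : DifferentiableAt ℂ (fun s : ℂ => (x : ℂ) ^ s) s :=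
    differentiableAt_id.const_cpow (Or.inl hx0)
  exact h1.add ((differentiableAt_const _).add (h2.mul
    ((Complex.differentiable_one_div_Gamma s).mul (differentiableAt_mellin_mellinKernel hx hs))))

lemma differentiableAt_cpow_mul_hurwitz (hb : 0 < x + b) (hx : x ≠ 0) {s : ℂ} (hs1 : s ≠ 1) :
    DifferentiableAt ℂ (fun s => (x : ℂ) ^ s * hurwitz (x + b) s) s :=
  (differentiableAt_id.const_cpow (Or.inl (by exact_mod_cast hx))).mul
    (differentiableAt_hurwitz hb hs1)

lemma cpow_mul_hurwitz_of_im_pos (hb : 0 < x + b) (hx : kernelType b < x) {s : ℂ}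
    (hs : -1 < s.re) (him : 0 < s.im) :
    (x : ℂ) ^ s * hurwitz (x + b) s = hurwitzContinuation b x s := by
  set U : Set ℂ := {s | -1 < s.re} ∩ {s | 0 < s.im} with hU
  have hUopen : IsOpen U := (isOpen_lt continuous_const Complex.continuous_re).inter
    (isOpen_lt continuous_const Complex.continuous_im)
  have hUconv : Convex ℝ U := (convex_halfSpace_re_gt _).inter (convex_halfSpace_im_gt _)
  have hne : ∀ s ∈ U, s ≠ 1 := by
    rintro s hs rfl
    simpa using hs.2
  have hx0 : x ≠ 0 := ((kernelType_nonneg b).trans_lt hx).ne'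
  have hf : AnalyticOnNhd ℂ (fun s => (x : ℂ) ^ s * hurwitz (x + b) s) U :=
    DifferentiableOn.analyticOnNhd (fun s hs =>
      (differentiableAt_cpow_mul_hurwitz hb hx0 (hne s hs)).differentiableWithinAt) hUopen
  have hg : AnalyticOnNhd ℂ (hurwitzContinuation b x) U :=
    DifferentiableOn.analyticOnNhd (fun s hs =>
      (differentiableAt_hurwitzContinuation hx hs.1 (hne s hs)).differentiableWithinAt) hUopen
  refine hf.eqOn_of_preconnected_of_eventuallyEq hg hUconv.isPreconnected
    (z₀ := 2 + Complex.I) ?_ ?_ ⟨hs, him⟩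
  · constructor <;> norm_num
  · have : {s : ℂ | 1 < s.re} ∈ 𝓝 (2 + Complex.I) :=
      (isOpen_lt continuous_const Complex.continuous_re).mem_nhds (by simp)
    filter_upwards [this] with t ht
    exact cpow_mul_hurwitz_of_one_lt_re hb hx ht

lemma laplaceRem_one {y : ℂ} (hy : kernelType b < y.re) :
    laplaceRem b 1 y = laplace (fun v => kernelFun b v - kernelFun b 0) y := by
  obtain ⟨C, -, hC⟩ := exists_norm_iteratedDeriv_kernelFun_le b one_pos
    (by linarith [Real.pi_gt_three])
  obtain ⟨C', -, hC'⟩ := exists_norm_kernelFun_sub_le_exp b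
  have hd : ∀ v : ℝ, HasDerivAt (fun v : ℝ => kernelFun b v - kernelFun b 0)
      (iteratedDeriv 1 (kernelFun b) v) v := fun v => by
    have := (hasDerivAt_iteratedDeriv_kernelFun b 0 v).sub_const (kernelFun b 0)
    simpa only [iteratedDeriv_zero] using this
  rw [laplace_eq_add hd (continuous_iteratedDeriv_kernelFun b 1) hC' (hC 1) hy
    (ne_zero_of_kernelType_lt hy), laplaceRem]
  simp

lemma hurwitzContinuation_eq (hx : kernelType b < x) {s : ℂ} (hs : |s.re| < 1) :
    hurwitzContinuation b x s = x / (s - 1) + hurwitzRem b s x := by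
  have hx0 : (x : ℂ) ≠ 0 := by exact_mod_cast ((kernelType_nonneg b).trans_lt hx).ne'
  obtain ⟨C, -, hC⟩ := exists_norm_kernelFun_sub_le b
  have h1 : stieltjes (laplaceRem b 1) s x =
      stieltjes (laplace fun v => kernelFun b v - kernelFun b 0) s x := by
    refine setIntegral_congr_fun measurableSet_Ioi fun w hw => ?_
    rw [laplaceRem_one (lt_re_mul_one_add (kernelType_nonneg b) (by simpa using hx) hw)]
  have h2 : (x : ℂ) * (x : ℂ) ^ (s - 1) = (x : ℂ) ^ s := by
    rw [Complex.cpow_sub _ _ hx0, Complex.cpow_one]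
    field_simp
  rw [hurwitzContinuation, hurwitzRem, h1,
    stieltjes_laplace (continuous_kernelFun_sub b) (kernelType_nonneg b) hC hx hs,
    ← sin_div_pi_mul_Gamma hs, ← h2]
  change _ = (x : ℂ) / (s - 1) + (kernelFun b 0 + x * (_ * (_ * _ * mellin (mellinKernel b x) s)))
  ring

lemma cpow_mul_hurwitz_eq (hb : 0 < x + b) (hx : kernelType b < x) {s : ℂ} (hs : ‖s‖ < 1) :
    (x : ℂ) ^ s * hurwitz (x + b) s = x / (s - 1) + hurwitzRem b s x := by
  have hx0 : x ≠ 0 := ((kernelType_nonneg b).trans_lt hx).ne'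
  have hre : ∀ s ∈ Metric.ball (0 : ℂ) 1, |s.re| < 1 := fun s hs =>
    (Complex.abs_re_le_norm s).trans_lt (mem_ball_zero_iff.1 hs)
  have hne : ∀ s ∈ Metric.ball (0 : ℂ) 1, s ≠ 1 := by
    rintro s hs rfl
    simp at hs
  have hf : AnalyticOnNhd ℂ (fun s => (x : ℂ) ^ s * hurwitz (x + b) s) (Metric.ball 0 1) :=
    DifferentiableOn.analyticOnNhd (fun s hs =>
      (differentiableAt_cpow_mul_hurwitz hb hx0 (hne s hs)).differentiableWithinAt)
      Metric.isOpen_ball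
  have hg : AnalyticOnNhd ℂ (fun s => (x : ℂ) / (s - 1) + hurwitzRem b s x) (Metric.ball 0 1) :=
    DifferentiableOn.analyticOnNhd (fun s hs => by
      refine DifferentiableAt.differentiableWithinAt (DifferentiableAt.add ?_ ?_)
      · exact (differentiableAt_const _).div (by fun_prop) (sub_ne_zero.2 (hne s hs))
      · exact differentiableAt_hurwitzRem_left (by simpa using hx) (hre s hs))
      Metric.isOpen_ball
  have hmem : (Complex.I / 2 : ℂ) ∈ Metric.ball (0 : ℂ) 1 := by
    simp
    norm_num
  refine hf.eqOn_of_preconnected_of_eventuallyEq hg (convex_ball 0 1).isPreconnected hmem ?_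
    (mem_ball_zero_iff.2 hs)
  have him : {s : ℂ | 0 < s.im} ∈ 𝓝 (Complex.I / 2 : ℂ) :=
    (isOpen_lt continuous_const Complex.continuous_im).mem_nhds (by simp)
  filter_upwards [Metric.isOpen_ball.mem_nhds hmem, him] with t ht ht'
  rw [cpow_mul_hurwitz_of_im_pos hb hx (by linarith [(abs_lt.1 (hre t ht)).1]) ht',
    hurwitzContinuation_eq hx (hre t ht)]

theorem maclaurinCoeff_cpow_mul_hurwitz {a : ℝ} (ha : 0 < a) (hx : 1 ≤ x) (n : ℕ) :
    maclaurinCoeff (fun s : ℂ => (x : ℂ) ^ s * hurwitz (x + a - 1) s) n =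
      -(x : ℂ) + maclaurinCoeff (fun s => hurwitzRem (a - 1) s x) n := by
  have hβ : kernelType (a - 1) < x := (kernelType_lt_one (by linarith)).trans_le hx
  have hev : (fun s : ℂ => (x : ℂ) ^ s * hurwitz (x + a - 1) s) =ᶠ[𝓝 0]
      fun s => x / (s - 1) + hurwitzRem (a - 1) s x := by
    filter_upwards [Metric.ball_mem_nhds (0 : ℂ) one_pos] with s hs
    rw [add_sub_assoc]
    exact cpow_mul_hurwitz_eq (by linarith) hβ (mem_ball_zero_iff.1 hs)
  rw [maclaurinCoeff_congr hev, maclaurinCoeff_add (f := fun s : ℂ => (x : ℂ) / (s - 1))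
    (analyticAt_const.div (by fun_prop) (by simp)) (analyticAt_hurwitzRem_left (by simpa using hβ)),
    maclaurinCoeff_div_sub_one]

theorem zetaCoeff_eq {a : ℝ} (ha : 0 < a) (n : ℕ) :
    zetaCoeff a n = -1 + maclaurinCoeff (fun s => hurwitzRem (a - 1) s 1) n := by
  have h := maclaurinCoeff_cpow_mul_hurwitz ha le_rfl n
  simp only [Complex.ofReal_one, Complex.one_cpow, one_mul, add_sub_cancel_left] at h
  exact h

theorem zetaCoeff_zero {a : ℝ} (ha : 0 < a) : zetaCoeff a 0 = -1 + (term a 0 0 : ℂ) := by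
  rw [zetaCoeff_eq ha, ← maclaurinCoeff_kernelFun_eq]
  simp [maclaurinCoeff, hurwitzRem]

theorem hasSum_zetaCoeff {a : ℝ} (ha : 0 < a) {s : ℂ} (hs : ‖s‖ < 1) :
    HasSum (fun n : ℕ => zetaCoeff a n * s ^ n) (hurwitz a s) := by
  have hd : DifferentiableOn ℂ (hurwitz a) (Metric.ball 0 1) := fun t ht =>
    (differentiableAt_hurwitz ha (by rintro rfl; simp at ht)).differentiableWithinAt
  have h := Complex.hasSum_taylorSeries_on_ball hd (mem_ball_zero_iff.2 hs)
  convert! h using 1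
  funext n
  rw [zetaCoeff, maclaurinCoeff, sub_zero, smul_eq_mul, smul_eq_mul]
  ring

end

/-! ### The size of the Stirling numbers of the first kind -/

lemma stirlingFirst_le (k n : ℕ) : (Nat.stirlingFirst (k + 1) (n + 1) : ℝ) ≤
    (k ! : ℝ) * (1 + 2 * Real.log (k + 1)) ^ n := by
  induction k generalizing n with
  | zero => cases n <;> simp [Nat.stirlingFirst]
  | succ k ih =>
    have hlog0 : 0 ≤ Real.log ((k : ℝ) + 1) := Real.log_nonneg (by
      have : (0 : ℝ) ≤ k := k.cast_nonneg
      linarith)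
    set L := 1 + 2 * Real.log ((k : ℝ) + 1) with hL
    have hL0 : 0 ≤ L := by positivity
    have hstep : L + 1 / ((k : ℝ) + 1) ≤ 1 + 2 * Real.log ((k + 1 : ℕ) + 1) := by
      have h1 := Real.one_sub_inv_le_log_of_pos
        (show 0 < ((k : ℝ) + 2) / (k + 1) by positivity)
      rw [Real.log_div (by positivity) (by positivity), inv_div] at h1
      have h2 : 1 / ((k : ℝ) + 1) ≤ 2 * (1 - ((k : ℝ) + 1) / (k + 2)) := by
        have h3 : 2 * (1 - ((k : ℝ) + 1) / (k + 2)) = 2 / (k + 2) := by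
          field_simp
          ring
        rw [h3, div_le_div_iff₀ (by positivity) (by positivity)]
        have : (0 : ℝ) ≤ k := k.cast_nonneg
        linarith
      push_cast
      rw [show (k : ℝ) + 1 + 1 = k + 2 by ring, hL]
      linarith
    rw [Nat.stirlingFirst_succ_succ, Nat.factorial_succ]
    push_cast at hstep ⊢
    cases n with
    | zero =>
      have h := ih 0
      rw [Nat.stirlingFirst_succ_zero]
      simp only [zero_add, pow_zero, mul_one, Nat.cast_zero, add_zero] at h ⊢
      gcongr
    | succ n =>
      have hp : 0 ≤ L + 1 / ((k : ℝ) + 1) := by positivity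
      calc ((k : ℝ) + 1) * (Nat.stirlingFirst (k + 1) (n + 1 + 1) : ℝ) +
            (Nat.stirlingFirst (k + 1) (n + 1) : ℝ)
          ≤ ((k : ℝ) + 1) * ((k ! : ℝ) * L ^ (n + 1)) + (k ! : ℝ) * L ^ n := by
            have h1 := ih (n + 1)
            have h2 := ih n
            gcongr
        _ = ((k : ℝ) + 1) * (k ! : ℝ) * (L ^ n * (L + 1 / ((k : ℝ) + 1))) := by
            field_simp
            ring
        _ ≤ ((k : ℝ) + 1) * (k ! : ℝ) *
            ((L + 1 / ((k : ℝ) + 1)) ^ n * (L + 1 / ((k : ℝ) + 1))) := by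
            gcongr
            exact le_add_of_nonneg_right (by positivity)
        _ ≤ _ := by
            rw [← pow_succ]
            gcongr

lemma pow_succ_sub_pow_succ_le {p q : ℝ} (hq : 0 ≤ q) (hpq : q ≤ p) (n : ℕ) :
    p ^ (n + 1) - q ^ (n + 1) ≤ (n + 1) * (p - q) * p ^ n := by
  have hp : 0 ≤ p := hq.trans hpq
  induction n with
  | zero => simp
  | succ n ih =>
    have h1 : q ^ (n + 1) ≤ p ^ (n + 1) := by gcongr
    have h2 : p ^ (n + 2) - q ^ (n + 2) =
        p * (p ^ (n + 1) - q ^ (n + 1)) + (p - q) * q ^ (n + 1) := by ring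
    rw [h2]
    calc _ ≤ p * ((n + 1) * (p - q) * p ^ n) + (p - q) * p ^ (n + 1) :=
          add_le_add (mul_le_mul_of_nonneg_left ih hp)
            (mul_le_mul_of_nonneg_left h1 (sub_nonneg.2 hpq))
      _ = _ := by push_cast; ring

lemma le_stirlingFirst (k n : ℕ) :
    (k ! : ℝ) * ((max 0 (Real.log (k + 1) - n)) ^ n / (n ! : ℝ)) ≤
      (Nat.stirlingFirst (k + 1) (n + 1) : ℝ) := by
  induction k generalizing n with
  | zero =>
    cases n with
    | zero => simp [Nat.stirlingFirst]
    | succ n =>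
      have : max 0 (Real.log (((0 : ℕ) : ℝ) + 1) - ((n + 1 : ℕ) : ℝ)) = 0 := by
        apply max_eq_left
        simp only [Nat.cast_zero, zero_add, Real.log_one, zero_sub, Left.neg_nonpos_iff]
        positivity
      rw [this]
      simp
  | succ k ih =>
    cases n with
    | zero => simp [Nat.stirlingFirst_one_right]
    | succ n =>
      rw [Nat.stirlingFirst_succ_succ]
      set p := max 0 (Real.log (((k + 1 : ℕ) : ℝ) + 1) - ((n + 1 : ℕ) : ℝ)) with hp
      set q := max 0 (Real.log ((k : ℝ) + 1) - ((n + 1 : ℕ) : ℝ)) with hq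
      have hlog : Real.log (((k + 1 : ℕ) : ℝ) + 1) ≤ Real.log ((k : ℝ) + 1) + 1 / (k + 1) := by
        have h1 := Real.log_le_sub_one_of_pos
          (show 0 < ((k : ℝ) + 2) / (k + 1) by positivity)
        rw [Real.log_div (by positivity) (by positivity)] at h1
        have h2 : ((k : ℝ) + 2) / (k + 1) - 1 = 1 / (k + 1) := by
          field_simp
          ring
        push_cast
        rw [show (k : ℝ) + 1 + 1 = k + 2 by ring]
        linarith
      have hle1 : 1 / ((k : ℝ) + 1) ≤ 1 := by
        rw [div_le_one (by positivity)]
        have : (0 : ℝ) ≤ k := k.cast_nonneg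
        linarith
      have hmono : Real.log ((k : ℝ) + 1) ≤ Real.log (((k + 1 : ℕ) : ℝ) + 1) := by
        apply Real.log_le_log (by positivity)
        push_cast
        linarith
      have hq0 : 0 ≤ q := le_max_left _ _
      have hqp : q ≤ p := max_le_max le_rfl (by linarith)
      have hpq : p - q ≤ 1 / ((k : ℝ) + 1) := by
        rw [sub_le_iff_le_add]
        refine max_le (by positivity) ?_
        have := le_max_right 0 (Real.log ((k : ℝ) + 1) - ((n + 1 : ℕ) : ℝ))
        linarith
      have hpn : p ≤ max 0 (Real.log ((k : ℝ) + 1) - n) := by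
        refine max_le_max le_rfl ?_
        push_cast at hlog ⊢
        linarith
      have hp0 : 0 ≤ p := hq0.trans hqp
      have hpow : p ^ (n + 1) ≤ q ^ (n + 1) +
          (n + 1) * (1 / ((k : ℝ) + 1)) * max 0 (Real.log ((k : ℝ) + 1) - n) ^ n := by
        have h := pow_succ_sub_pow_succ_le hq0 hqp n
        have h2 : (n + 1) * (p - q) * p ^ n ≤
            (n + 1) * (1 / ((k : ℝ) + 1)) * max 0 (Real.log ((k : ℝ) + 1) - n) ^ n := by
          gcongr
        linarith
      have h1 := ih (n + 1)
      have h2 := ih n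
      rw [← hq] at h1
      calc ((k + 1)! : ℝ) * (p ^ (n + 1) / ((n + 1)! : ℝ))
          ≤ ((k + 1)! : ℝ) * ((q ^ (n + 1) + (n + 1) * (1 / ((k : ℝ) + 1)) *
              max 0 (Real.log ((k : ℝ) + 1) - n) ^ n) / ((n + 1)! : ℝ)) := by gcongr
        _ = ((k : ℝ) + 1) * ((k ! : ℝ) * (q ^ (n + 1) / ((n + 1)! : ℝ))) +
              (k ! : ℝ) * (max 0 (Real.log ((k : ℝ) + 1) - n) ^ n / (n ! : ℝ)) := by
            rw [Nat.factorial_succ, Nat.factorial_succ]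
            push_cast
            field_simp
        _ ≤ _ := by
            push_cast
            gcongr

/-! ### The size of the Bernoulli polynomials -/

/-- The value `(2 π) ^ j B_j(x) / j!`. -/
noncomputable def bernoulliScaled (x : ℝ) (j : ℕ) : ℝ :=
  (2 * Real.pi) ^ j * (Polynomial.aeval x (Polynomial.bernoulli j) / (j ! : ℝ))

/-- The limit along the even and along the odd numbers of `|(2 π) ^ j B_j(x) / j!| / 2`. -/
noncomputable def trigParity (x : ℝ) (j : ℕ) : ℝ :=
  if Even j then |Real.cos (2 * Real.pi * x)| else |Real.sin (2 * Real.pi * x)|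

lemma abs_sub_le_of_hasSum {u : ℕ → ℝ} (hu : ∀ n, |u n| ≤ 1) {j : ℕ} (hj : 2 ≤ j) {S : ℝ}
    (hS : HasSum (fun n : ℕ => 1 / (n : ℝ) ^ j * u n) S) :
    |S - u 1| ≤ (∑' n : ℕ, 1 / (n : ℝ) ^ 2) * 4 / 2 ^ j := by
  have h2 := hS.sub (hasSum_ite_eq 1 (u 1))
  have hsum : Summable fun n : ℕ => 1 / (n : ℝ) ^ 2 := Real.summable_one_div_nat_pow.2 one_lt_two
  have hb : ∀ n : ℕ, ‖1 / (n : ℝ) ^ j * u n - (if n = 1 then u 1 else 0)‖ ≤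
      1 / (n : ℝ) ^ 2 * (4 / 2 ^ j) := by
    intro n
    rcases eq_or_ne n 1 with rfl | hn1
    · simp
      positivity
    rcases Nat.eq_zero_or_pos n with rfl | hn
    · have : j ≠ 0 := by omega
      simp [this]
    have hn2 : (2 : ℝ) ≤ n := by
      have : 2 ≤ n := by omega
      exact_mod_cast this
    obtain ⟨i, rfl⟩ : ∃ i, j = i + 2 := ⟨j - 2, by omega⟩
    rw [if_neg hn1, sub_zero, Real.norm_eq_abs, abs_mul, abs_of_nonneg (by positivity)]
    calc 1 / (n : ℝ) ^ (i + 2) * |u n| ≤ 1 / (n : ℝ) ^ (i + 2) * 1 := by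
          gcongr
          exact hu n
      _ = 1 / (n : ℝ) ^ 2 * (1 / (n : ℝ) ^ i) := by
          rw [pow_add]
          field_simp
      _ ≤ 1 / (n : ℝ) ^ 2 * (1 / 2 ^ i) := by gcongr
      _ = _ := by
          rw [pow_add]
          field_simp
          norm_num
  have h3 := tsum_of_norm_bounded (hsum.hasSum.mul_right (4 / 2 ^ j)) hb
  rw [h2.tsum_eq] at h3
  rw [mul_div_assoc]
  exact h3

lemma tendsto_abs_bernoulliScaled_sub {x : ℝ} (hx : x ∈ Icc (0 : ℝ) 1) :
    Tendsto (fun j => |bernoulliScaled x j| - 2 * trigParity x j) atTop (𝓝 0) := by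
  set C := (∑' n : ℕ, 1 / (n : ℝ) ^ 2) * 4 with hC
  have hlim : Tendsto (fun j : ℕ => 2 * (C / 2 ^ j)) atTop (𝓝 0) := by
    have h1 : Tendsto (fun j : ℕ => (2 : ℝ) ^ j) atTop atTop :=
      tendsto_pow_atTop_atTop_of_one_lt one_lt_two
    simpa using (h1.const_div_atTop C).const_mul 2
  refine squeeze_zero_norm' ?_ hlim
  filter_upwards [eventually_ge_atTop 2] with j hj
  have key : ∀ S v : ℝ, |bernoulliScaled x j| = 2 * |S| → |S - v| ≤ C / 2 ^ j →
      ‖|bernoulliScaled x j| - 2 * |v|‖ ≤ 2 * (C / 2 ^ j) := by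
    intro S v h1 h2
    rw [h1, ← mul_sub, norm_mul, Real.norm_eq_abs, Real.norm_eq_abs, abs_two]
    have := (abs_abs_sub_abs_le_abs_sub S v).trans h2
    gcongr
  rcases Nat.even_or_odd j with he | ho
  · rw [trigParity, if_pos he]
    obtain ⟨k, rfl⟩ := he.two_dvd
    have hS := hasSum_one_div_nat_pow_mul_cos (k := k) (by omega) hx
    have h := abs_sub_le_of_hasSum (fun n => Real.abs_cos_le_one _) hj hS
    rw [Nat.cast_one, mul_one] at h
    refine key _ _ ?_ h
    rw [bernoulliScaled, Polynomial.eval_map, ← Polynomial.aeval_def]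
    simp only [abs_mul, abs_div, abs_pow, abs_neg, abs_one, one_pow]
    norm_num
    ring
  · rw [trigParity, if_neg (Nat.not_even_iff_odd.2 ho)]
    obtain ⟨k, rfl⟩ := ho
    have hS := hasSum_one_div_nat_pow_mul_sin (k := k) (by omega) hx
    have h := abs_sub_le_of_hasSum (fun n => Real.abs_sin_le_one _) hj hS
    rw [Nat.cast_one, mul_one] at h
    refine key _ _ ?_ h
    rw [bernoulliScaled, Polynomial.eval_map, ← Polynomial.aeval_def]
    simp only [abs_mul, abs_div, abs_pow, abs_neg, abs_one, one_pow]
    norm_num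
    ring

lemma tendsto_bernoulliScaled_add_one_sub (x : ℝ) :
    Tendsto (fun j => bernoulliScaled (x + 1) j - bernoulliScaled x j) atTop (𝓝 0) := by
  rw [← tendsto_add_atTop_iff_nat 1]
  have h : ∀ j : ℕ, bernoulliScaled (x + 1) (j + 1) - bernoulliScaled x (j + 1) =
      2 * Real.pi * ((2 * Real.pi * x) ^ j / (j ! : ℝ)) := by
    intro j
    have h1 := congrArg (Polynomial.aeval x) (Polynomial.bernoulli_comp_one_add_X (j + 1))
    rw [Polynomial.aeval_comp] at h1
    simp only [map_add, map_one, Polynomial.aeval_X, map_nsmul, map_pow,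
      Nat.add_sub_cancel] at h1
    rw [bernoulliScaled, bernoulliScaled, add_comm x 1, h1, Nat.factorial_succ, nsmul_eq_mul,
      mul_pow]
    push_cast
    field_simp
    ring
  simp only [h]
  simpa using (FloorSemiring.tendsto_pow_div_factorial_atTop (2 * Real.pi * x)).const_mul
    (2 * Real.pi)

lemma tendsto_bernoulliScaled_add_nat_sub (x : ℝ) (m : ℕ) :
    Tendsto (fun j => bernoulliScaled (x + m) j - bernoulliScaled x j) atTop (𝓝 0) := by
  induction m with
  | zero => simp
  | succ m ih =>
    have := (tendsto_bernoulliScaled_add_one_sub (x + m)).add ih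
    simp only [add_zero, sub_add_sub_cancel] at this
    push_cast
    simpa only [add_assoc] using this

lemma tendsto_abs_bernoulliScaled_sub_of_pos {a : ℝ} (ha : 0 < a) :
    Tendsto (fun j => |bernoulliScaled (a - 1) j| - 2 * trigParity (Int.fract a) j)
      atTop (𝓝 0) := by
  have h1 := tendsto_bernoulliScaled_add_one_sub (a - 1)
  have h2 := tendsto_bernoulliScaled_add_nat_sub (Int.fract a) ⌊a⌋₊
  have hfl : Int.fract a + ⌊a⌋₊ = a := by
    rw [natCast_floor_eq_intCast_floor ha.le, Int.fract_add_floor]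
  rw [hfl] at h2
  rw [sub_add_cancel] at h1
  have h3 := tendsto_abs_bernoulliScaled_sub (x := Int.fract a)
    ⟨Int.fract_nonneg a, (Int.fract_lt_one a).le⟩
  have h4 : Tendsto (fun j => |bernoulliScaled (a - 1) j| -
      |bernoulliScaled (Int.fract a) j|) atTop (𝓝 0) := by
    refine squeeze_zero_norm (fun j => abs_abs_sub_abs_le_abs_sub _ _) ?_
    have := (h2.sub h1).abs
    simpa using this
  simpa using h4.add h3

lemma trigParity_le_one (x : ℝ) (j : ℕ) : trigParity x j ≤ 1 := by
  unfold trigParity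
  split_ifs
  · exact Real.abs_cos_le_one _
  · exact Real.abs_sin_le_one _

lemma exists_frequently_trigParity (x : ℝ) : ∃ c : ℝ, 0 < c ∧ ∃ᶠ j in atTop, trigParity x j = c := by
  by_cases h : Real.cos (2 * Real.pi * x) = 0
  · have hs : Real.sin (2 * Real.pi * x) ≠ 0 := fun h' => by
      have := Real.sin_sq_add_cos_sq (2 * Real.pi * x)
      rw [h, h'] at this
      norm_num at this
    refine ⟨_, abs_pos.2 hs, ?_⟩
    rw [frequently_atTop]
    intro N
    exact ⟨2 * N + 1, by omega, if_neg (by simp)⟩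
  · refine ⟨_, abs_pos.2 h, ?_⟩
    rw [frequently_atTop]
    intro N
    exact ⟨2 * N, by omega, if_pos (by simp)⟩

lemma eventually_abs_bernoulliScaled_le {a : ℝ} (ha : 0 < a) :
    ∀ᶠ j in atTop, |bernoulliScaled (a - 1) j| ≤ 3 := by
  filter_upwards [(tendsto_abs_bernoulliScaled_sub_of_pos ha).eventually (gt_mem_nhds one_pos)]
    with j hj
  have := trigParity_le_one (Int.fract a) j
  linarith

lemma exists_frequently_le_abs_bernoulliScaled {a : ℝ} (ha : 0 < a) :
    ∃ c : ℝ, 0 < c ∧ ∃ᶠ j in atTop, c ≤ |bernoulliScaled (a - 1) j| := by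
  obtain ⟨c, hc, hf⟩ := exists_frequently_trigParity (Int.fract a)
  refine ⟨c, hc, ?_⟩
  refine (hf.and_eventually ((tendsto_abs_bernoulliScaled_sub_of_pos ha).eventually
    (lt_mem_nhds (neg_lt_zero.2 hc)))).mono fun j hj => ?_
  linarith [hj.1, hj.2]

/-! ### The order of the terms -/

/-- The comparison sequence for the terms. -/
noncomputable def termScale (n k : ℕ) : ℝ :=
  ((k - 1)! : ℝ) * Real.log k ^ (n - 1) / (2 * Real.pi) ^ k

lemma abs_term (a : ℝ) (n k : ℕ) : |term a n k| =
    (Nat.stirlingFirst k n : ℝ) / (2 * Real.pi) ^ k *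
      (|bernoulliScaled (a - 1) (k + 1)| / (2 * Real.pi)) := by
  have hpi := Real.pi_pos
  rw [term, bernoulliScaled]
  simp only [abs_mul, abs_div, abs_pow, abs_neg, abs_one, one_pow, one_mul, Nat.abs_cast,
    abs_of_pos Real.pi_pos, abs_two]
  rw [pow_succ]
  field_simp

lemma eventually_stirlingFirst_le {n : ℕ} (hn : 1 ≤ n) : ∀ᶠ k : ℕ in atTop,
    (Nat.stirlingFirst k n : ℝ) / (2 * Real.pi) ^ k ≤ 3 ^ (n - 1) * termScale n k := by
  have hlog : ∀ᶠ k : ℕ in atTop, 1 ≤ Real.log k :=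
    (Real.tendsto_log_atTop.comp tendsto_natCast_atTop_atTop).eventually_ge_atTop 1
  filter_upwards [hlog, eventually_ge_atTop 1] with k hk hk1
  obtain ⟨k, rfl⟩ : ∃ i, k = i + 1 := ⟨k - 1, by omega⟩
  obtain ⟨n, rfl⟩ : ∃ i, n = i + 1 := ⟨n - 1, by omega⟩
  have hpi := Real.pi_pos
  have h := stirlingFirst_le k n
  push_cast at hk
  rw [termScale, Nat.add_sub_cancel, Nat.add_sub_cancel]
  push_cast
  calc _ ≤ (k ! : ℝ) * (1 + 2 * Real.log (k + 1)) ^ n / (2 * Real.pi) ^ (k + 1) := by gcongr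
    _ ≤ (k ! : ℝ) * (3 * Real.log (k + 1)) ^ n / (2 * Real.pi) ^ (k + 1) := by
        gcongr
        linarith
    _ = _ := by
        rw [mul_pow]
        ring

lemma eventually_le_stirlingFirst {n : ℕ} (hn : 1 ≤ n) : ∀ᶠ k : ℕ in atTop,
    termScale n k / (2 ^ (n - 1) * ((n - 1)! : ℝ)) ≤
      (Nat.stirlingFirst k n : ℝ) / (2 * Real.pi) ^ k := by
  have hlog : ∀ᶠ k : ℕ in atTop, 2 * (n : ℝ) ≤ Real.log k :=
    (Real.tendsto_log_atTop.comp tendsto_natCast_atTop_atTop).eventually_ge_atTop _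
  filter_upwards [hlog, eventually_ge_atTop 1] with k hk hk1
  obtain ⟨k, rfl⟩ : ∃ i, k = i + 1 := ⟨k - 1, by omega⟩
  obtain ⟨n, rfl⟩ : ∃ i, n = i + 1 := ⟨n - 1, by omega⟩
  have hpi := Real.pi_pos
  have h := le_stirlingFirst k n
  push_cast at hk
  rw [termScale, Nat.add_sub_cancel, Nat.add_sub_cancel]
  push_cast
  have h0 : 0 ≤ Real.log ((k : ℝ) + 1) := by
    have : (0 : ℝ) ≤ n := n.cast_nonneg
    linarith
  calc _ = (k ! : ℝ) * ((Real.log (k + 1) / 2) ^ n / (n ! : ℝ)) / (2 * Real.pi) ^ (k + 1) := by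
        rw [div_pow]
        field_simp
    _ ≤ (k ! : ℝ) * (max 0 (Real.log (k + 1) - n) ^ n / (n ! : ℝ)) /
          (2 * Real.pi) ^ (k + 1) := by
        gcongr
        refine le_max_of_le_right ?_
        linarith
    _ ≤ _ := by gcongr

lemma eventually_one_le_termScale (n : ℕ) : ∀ᶠ k : ℕ in atTop, 1 ≤ termScale n k := by
  have hlog : ∀ᶠ k : ℕ in atTop, 1 ≤ Real.log k :=
    (Real.tendsto_log_atTop.comp tendsto_natCast_atTop_atTop).eventually_ge_atTop 1
  have h := (FloorSemiring.tendsto_pow_div_factorial_atTop (2 * Real.pi)).const_mul (2 * Real.pi)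
  rw [mul_zero] at h
  have h' : ∀ᶠ k : ℕ in atTop, 2 * Real.pi * ((2 * Real.pi) ^ (k - 1) / ((k - 1)! : ℝ)) ≤ 1 :=
    (tendsto_sub_atTop_nat 1).eventually (h.eventually_le_const one_pos)
  filter_upwards [hlog, h', eventually_ge_atTop 1] with k hk hk' hk1
  have hpi := Real.pi_pos
  rw [mul_div_assoc', ← pow_succ', Nat.sub_add_cancel hk1, div_le_one (by positivity)] at hk'
  rw [termScale, one_le_div (by positivity)]
  exact hk'.trans (le_mul_of_one_le_right (by positivity) (one_le_pow₀ hk))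

theorem term_isBigO {a : ℝ} (ha : 0 < a) {n : ℕ} (hn : 1 ≤ n) : term a n =O[atTop] termScale n := by
  refine IsBigO.of_bound (3 ^ (n - 1) * (3 / (2 * Real.pi))) ?_
  filter_upwards [eventually_stirlingFirst_le hn, eventually_one_le_termScale n,
    (tendsto_add_atTop_nat 1).eventually (eventually_abs_bernoulliScaled_le ha)] with k h1 h2 h3
  have hpi := Real.pi_pos
  rw [Real.norm_eq_abs, abs_term, Real.norm_of_nonneg (by linarith)]
  calc _ ≤ 3 ^ (n - 1) * termScale n k * (3 / (2 * Real.pi)) := by gcongr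
    _ = _ := by ring

theorem exists_frequently_le_abs_term {a : ℝ} (ha : 0 < a) {n : ℕ} (hn : 1 ≤ n) :
    ∃ c : ℝ, 0 < c ∧ ∃ᶠ k in atTop, c * termScale n k ≤ |term a n k| := by
  obtain ⟨c, hc, hf⟩ := exists_frequently_le_abs_bernoulliScaled ha
  have hpi := Real.pi_pos
  refine ⟨1 / (2 ^ (n - 1) * ((n - 1)! : ℝ)) * (c / (2 * Real.pi)), by positivity, ?_⟩
  have hf' : ∃ᶠ k in atTop, c ≤ |bernoulliScaled (a - 1) (k + 1)| := by
    rw [frequently_atTop] at hf ⊢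
    intro N
    obtain ⟨j, hj, hcj⟩ := hf (N + 1)
    refine ⟨j - 1, by omega, ?_⟩
    rwa [Nat.sub_add_cancel (by omega)]
  refine (hf'.and_eventually (eventually_le_stirlingFirst hn)).mono fun k hk => ?_
  rw [abs_term]
  calc _ = termScale n k / (2 ^ (n - 1) * ((n - 1)! : ℝ)) * (c / (2 * Real.pi)) := by ring
    _ ≤ _ := mul_le_mul hk.2 (div_le_div_of_nonneg_right hk.1 (by positivity)) (by positivity)
      (by positivity)

theorem term_not_isLittleO {a : ℝ} (ha : 0 < a) {n : ℕ} (hn : 1 ≤ n) :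
    ¬ term a n =o[atTop] termScale n := by
  intro h
  obtain ⟨c, hc, hf⟩ := exists_frequently_le_abs_term ha hn
  obtain ⟨k, ⟨h1, h2⟩, h3⟩ := ((hf.and_eventually (h.def (half_pos hc))).and_eventually
    (eventually_one_le_termScale n)).exists
  rw [Real.norm_eq_abs, Real.norm_of_nonneg (by linarith)] at h2
  nlinarith

theorem not_tendsto_sum_term {a : ℝ} (ha : 0 < a) {n : ℕ} (hn : 1 ≤ n) :
    ¬ ∃ L : ℝ, Tendsto (fun K : ℕ => ∑ k ∈ Finset.range K, term a n k) atTop (𝓝 L) := by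
  rintro ⟨L, hL⟩
  have h0 : Tendsto (term a n) atTop (𝓝 0) := by
    have := (hL.comp (tendsto_add_atTop_nat 1)).sub hL
    simpa [Function.comp_def, Finset.sum_range_succ] using this
  obtain ⟨c, hc, hf⟩ := exists_frequently_le_abs_term ha hn
  have habs := h0.abs
  rw [abs_zero] at habs
  obtain ⟨k, ⟨h1, h2⟩, h3⟩ := ((hf.and_eventually (habs.eventually (gt_mem_nhds hc))).and_eventually
    (eventually_one_le_termScale n)).exists
  nlinarith

theorem term_zero_of_pos (a : ℝ) {k : ℕ} (hk : 1 ≤ k) : term a 0 k = 0 := by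
  obtain ⟨j, rfl⟩ : ∃ j, k = j + 1 := ⟨k - 1, by omega⟩
  simp [term]

end HurwitzTaylor

open HurwitzTaylor in
theorem theorem1 (a : ℝ) (ha : 0 < a) :
    -- the Maclaurin series of the Hurwitz zeta function
    (∀ s : ℂ, ‖s‖ < 1 → HasSum (fun n : ℕ => zetaCoeff a n * s ^ n) (hurwitz a s)) ∧
    -- the coefficients as semi-convergent series, the case `z = 1` of an asymptotic expansion
    (∀ n : ℕ, ∃ F : ℂ → ℂ,
      IsSemiconvergentExpansion (fun k => (term a n k : ℂ)) (2 * Real.pi) F ∧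
      zetaCoeff a n = -1 + F 1 ∧
      ∀ x : ℝ, 1 ≤ x →
        maclaurinCoeff (fun s : ℂ => (x : ℂ) ^ s * hurwitz (x + a - 1) s) n = -(x : ℂ) + F x) ∧
    -- for `n = 0` the series is finite and the identity is exact
    ((∀ k : ℕ, 1 ≤ k → term a 0 k = 0) ∧ zetaCoeff a 0 = -1 + (term a 0 0 : ℂ)) ∧
    -- for `n ≥ 1` the order of the terms is `(k - 1)! (log k) ^ (n - 1) / (2 π) ^ k`,
    -- and the series diverges
    (∀ n : ℕ, 1 ≤ n →
      (term a n =O[atTop]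
        fun k : ℕ => ((k - 1)! : ℝ) * Real.log k ^ (n - 1) / (2 * Real.pi) ^ k) ∧
      (¬ term a n =o[atTop]
        fun k : ℕ => ((k - 1)! : ℝ) * Real.log k ^ (n - 1) / (2 * Real.pi) ^ k) ∧
      ¬ ∃ L : ℝ, Tendsto (fun K : ℕ => ∑ k ∈ Finset.range K, term a n k) atTop (𝓝 L)) := by
  refine ⟨fun s hs => hasSum_zetaCoeff ha hs, fun n => ?_,
    ⟨fun k hk => term_zero_of_pos a hk, zetaCoeff_zero ha⟩, fun n hn =>
      ⟨term_isBigO ha hn, term_not_isLittleO ha hn, not_tendsto_sum_term ha hn⟩⟩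
  exact ⟨fun z => maclaurinCoeff (fun s => hurwitzRem (a - 1) s z) n,
    isSemiconvergentExpansion_hurwitzRem ha n, zetaCoeff_eq ha n,
    fun x hx => maclaurinCoeff_cpow_mul_hurwitz ha hx n⟩
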